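/- A diagram $D$ of an $l$-component link is the image of a link with $l$ components, smoothly embedded in $\mathbb{R}^3$, under the projection $\mathbb{R}^3\to\mathbb{R}^2$, where the projection restricted to the link is an immersion whose only singular points are transverse double points (the crossings); each crossing carries over/under information. A diagram on the sphere $S^2=\mathbb{R}^2\cup\{\infty\}$ is obtained in the same way, with $\infty$ not on the projection image. The regions of $D$ are the connected components of the complement of the projection image in $\mathbb{R}^2$ or in $S^2$, respectively. The tangent lines of the two branches at a crossing bound four corners at that crossing. The sign of a corner is $+1$ if the turn through the corner from the underpass to the overpass is counterclockwise, and $-1$ if it is clockwise. Assume that $D$ has $n\ge 1$ crossings $x_1,\dots,x_n$ and that its projection image has $d$ connected components. Then $D$ has $n+d+1$ regions $R_1,\dots,R_{n+d+1}$. The definite region choice matrix of the double counting rule $A_{d2}(D)$ is the $n\times(n+d+1)$ integer matrix whose $(i,j)$ entry is the number of corners ($0$, $1$ or $2$) at which $R_j$ touches $x_i$. The alternating region choice matrix of the double counting rule $A_{a2}(D)$ is the $n\times(n+d+1)$ integer matrix whose $(i,j)$ entry is the sum of the signs of the corners at which $R_j$ touches $x_i$. Theorem. Both $A_{d2}(D)$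 and $A_{a2}(D)$ have rank $n+d-l$, and both $\mathbb{Z}$-submodules $\{\mathbf{u}\in\mathbb{Z}^{n+d+1}\mid A_{d2}(D)\mathbf{u}=\mathbf{0}\}$ and $\{\mathbf{u}\in\mathbb{Z}^{n+d+1}\mid A_{a2}(D)\mathbf{u}=\mathbf{0}\}$ have rank $l+1$. -/

import Mathlib

open scoped ContDiff Topology

noncomputable section

/-- The connected components of a subset `S` of a topological space. -/
def components {X : Type*} [TopologicalSpace X] (S : Set X) : Set (Set X) :=
  {C | ∃ z ∈ S, C = connectedComponentIn S z}

/-- Parameters of the points of a disjoint union of `l` circles of length one: the index of the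
circle together with the representative of the point in `[0, 1)`. -/
def circlePoints (l : ℕ) : Set (Fin l × ℝ) :=
  {p | p.2 ∈ Set.Ico (0 : ℝ) 1}

/-- A diagram of an `l`-component link: a smooth link in `ℝ³ = ℂ × ℝ`, given by `1`-periodic
parametrisations of its components, whose projection to the plane `ℝ² = ℂ` is an immersion with no
other singular points than transverse double points. The over/under information at a double point
is read off from the last coordinate. -/
structure LinkDiagram (l : ℕ) where
  knot : Fin l → ℝ → ℂ × ℝ
  smooth : ∀ i, ContDiff ℝ ∞ (knot i)
  periodic : ∀ i, Function.Periodic (knot i) 1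
  embedded : Set.InjOn (fun p : Fin l × ℝ => knot p.1 p.2) (circlePoints l)
  immersed : ∀ i t, deriv (fun s => (knot i s).1) t ≠ 0
  transverse : ∀ p ∈ circlePoints l, ∀ q ∈ circlePoints l, p ≠ q →
    (knot p.1 p.2).1 = (knot q.1 q.2).1 →
    LinearIndependent ℝ ![deriv (fun s => (knot p.1 s).1) p.2, deriv (fun s => (knot q.1 s).1) q.2]
  double : ∀ p ∈ circlePoints l, ∀ q ∈ circlePoints l, ∀ r ∈ circlePoints l,
    (knot p.1 p.2).1 = (knot q.1 q.2).1 → (knot q.1 q.2).1 = (knot r.1 r.2).1 →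
    p = q ∨ q = r ∨ p = r

namespace LinkDiagram

variable {l : ℕ} (D : LinkDiagram l)

/-- The projection of a point of the link to the plane. -/
def proj (p : Fin l × ℝ) : ℂ := (D.knot p.1 p.2).1

/-- The height of a point of the link over the plane. -/
def height (p : Fin l × ℝ) : ℝ := (D.knot p.1 p.2).2

/-- The tangent vector of the projected curve. -/
def tangent (p : Fin l × ℝ) : ℂ := deriv (fun s => (D.knot p.1 s).1) p.2

/-- The projection image of the link in the plane. -/
def image : Set ℂ := D.proj '' circlePoints l

/-- A crossing of the diagram, recorded by the parameters of its overpass and of its underpass.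
Since there are no triple points and the link is embedded, there is exactly one such pair for each
double point of the projection. -/
@[ext]
structure Crossing where
  overpass : Fin l × ℝ
  underpass : Fin l × ℝ
  overpass_mem : overpass ∈ circlePoints l
  underpass_mem : underpass ∈ circlePoints l
  proj_eq : D.proj overpass = D.proj underpass
  height_lt : D.height underpass < D.height overpass

/-- The regions of the diagram on a surface `X` that contains the plane through `ι : ℂ → X`:
the connected components of the complement of the projection image. The surface is the plane
(`ι = id`) or the sphere `OnePoint ℂ = ℂ ∪ {∞}` (with the inclusion of `ℂ`). -/
def regions {X : Type*} [TopologicalSpace X] (ι : ℂ → X) : Set (Set X) :=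
  components (ι '' D.image)ᶜ

variable {D}

/-- The four corners at a crossing are indexed by two signs `ε, δ`: the corner lies between the
half `overRay ε` of the overpass and the half `underRay δ` of the underpass. -/
def Crossing.overRay (c : D.Crossing) (ε : ℤˣ) : ℂ := ((ε : ℤ) : ℂ) * D.tangent c.overpass

/-- The tangent direction of one of the two halves of the underpass. -/
def Crossing.underRay (c : D.Crossing) (δ : ℤˣ) : ℂ := ((δ : ℤ) : ℂ) * D.tangent c.underpass

/-- The set `R` touches the crossing `c` at the corner `(ε, δ)`: it contains all points close to
the crossing on a half-line that leaves the crossing into that corner. -/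
def Crossing.TouchesAt {X : Type*} (c : D.Crossing) (ι : ℂ → X) (R : Set X) (ε δ : ℤˣ) : Prop :=
  ∀ᶠ t : ℝ in 𝓝[>] 0, ι (D.proj c.overpass + t * (c.overRay ε + c.underRay δ)) ∈ R

/-- The sign of the corner `(ε, δ)`: it is `1` if the turn through the corner from the underpass
to the overpass is counterclockwise, and `-1` if it is clockwise. The real number whose sign is
taken is the determinant of the pair `(underRay δ, overRay ε)`. -/
def Crossing.cornerSign (c : D.Crossing) (ε δ : ℤˣ) : ℤ :=
  (SignType.sign ((c.underRay δ).re * (c.overRay ε).im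
    - (c.underRay δ).im * (c.overRay ε).re) : SignType)

variable (D)

open Classical in
/-- The definite region choice matrix of the double counting rule: the entry at a crossing and a
region is the number of corners at which the region touches the crossing. -/
def definiteMatrix {X : Type*} [TopologicalSpace X] (ι : ℂ → X) :
    Matrix D.Crossing (D.regions ι) ℤ :=
  fun c R => ∑ ε : ℤˣ, ∑ δ : ℤˣ, if c.TouchesAt ι R ε δ then 1 else 0

open Classical in
/-- The alternating region choice matrix of the double counting rule: the entry at a crossing and
a region is the sum of the signs of the corners at which the region touches the crossing. -/
def alternatingMatrix {X : Type*} [TopologicalSpace X] (ι : ℂ → X) :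
    Matrix D.Crossing (D.regions ι) ℤ :=
  fun c R => ∑ ε : ℤˣ, ∑ δ : ℤˣ, if c.TouchesAt ι R ε δ then c.cornerSign ε δ else 0

end LinkDiagram

end

/-! Let `u` be a complex function on the regions of the plane diagram. Along a component of the link
consider its jump, the value on the left minus the value on the right. The jump is constant between
crossings. At a crossing `c` it breaks by minus the alternating corner sum `w c` of `u` on the
overpass, and by plus `w c` on the underpass (`exists_jump_limits_pass`). Going once around a
component, the breaks add up to zero. So the vector of corner sums is in the kernel of the incidence
matrix of the graph whose vertices are the link components and whose edges are the crossings
(`exists_jump_eq`).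

Conversely, each kernel vector `w` and each choice of initial jumps is realised. The Cauchy integral
over the link, with piecewise constant density having these breaks, is constant on every region
(`hasDerivAt_linkIntegral`, `linkIntegral_eq`) and jumps across the link by `2πi` times the density
(`tendsto_cauchyIntegral_jump`). A function without jumps is constant (`eq_of_cornerSum_eq_zero`).
Therefore the functions on the regions form a space isomorphic to `ℂ × ℂ^l × ker` of the incidence
matrix, the last coordinate being the corner sum (`exists_equiv`).

The kernel of the transposed incidence matrix consists of the functions of the connected components
of the projection image (`ker_incidenceMatrix_transpose`). So the incidence matrix has rank `l - d`
and nullity `n + d - l`. This gives both the number `1 + l + (n + d - l)` of regions and the rank `n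
+ d - l` of the alternating matrix.

For the definite matrix, a function with jump one everywhere is exponentiated to a checkerboard
colouring. Multiplication by invertible diagonal matrices then turns one matrix into the other
(`rank_definiteMatrix`). Ranks over `ℤ` and `ℂ` agree, rank-nullity gives the kernels, and passing
to the sphere adds one point to the exterior region only. -/

theorem IsPreconnected.eq_of_eventually_eq {X Y : Type*} [TopologicalSpace X] {s : Set X}
    (hs : IsPreconnected s) {f : X → Y} (h : ∀ x ∈ s, ∀ᶠ y in 𝓝[s] x, f y = f x) {x y : X}
    (hx : x ∈ s) (hy : y ∈ s) : f x = f y := by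
  -- For the discrete topology on the target, locally constant means continuous.
  let _ : TopologicalSpace Y := ⊥
  have : DiscreteTopology Y := ⟨rfl⟩
  refine hs.constant (f := f) (fun z hz => ?_) hx hy
  rw [ContinuousWithinAt, nhds_discrete]
  exact Filter.tendsto_pure.2 (h z hz)

/-! ### Charts of the plane along two transverse curves -/

/-- The determinant of a pair of vectors of the plane. -/
noncomputable def planeDet (a b : ℂ) : ℝ := a.re * b.im - a.im * b.re

theorem planeDet_ne_zero {a b : ℂ} (h : LinearIndependent ℝ ![a, b]) : planeDet a b ≠ 0 := by
  intro h0
  rw [planeDet] at h0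
  have := LinearIndependent.pair_iff.1 h
  by_cases hb : b = 0
  · have := this 0 1 (by simp [hb])
    simp at this
  · have h1 := this b.re (-a.re) (by
      apply Complex.ext <;> simp <;> linarith)
    have h2 := this b.im (-a.im) (by
      apply Complex.ext <;> simp <;> linarith)
    exact hb (Complex.ext (by simpa using h1.1) (by simpa using h2.1))

theorem planeDet_smul_add {a b v : ℂ} (h : planeDet a b ≠ 0) :
    v = ((planeDet v b / planeDet a b : ℝ) : ℂ) * a + ((planeDet a v / planeDet a b : ℝ) : ℂ) * b := by
  have h' := h
  apply Complex.ext
  · simp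
    field_simp
    simp only [planeDet]; ring
  · simp
    field_simp
    simp only [planeDet]; ring

theorem continuous_planeDet : Continuous fun x : ℂ × ℂ => planeDet x.1 x.2 := by
  unfold planeDet; fun_prop

/-- The linear coordinates on the plane with respect to a basis. -/
noncomputable def planeEquiv (a b : ℂ) (h : planeDet a b ≠ 0) : (ℝ × ℝ) ≃L[ℝ] ℂ :=
  LinearEquiv.toContinuousLinearEquiv
    { toFun := fun x => x.1 • a + x.2 • b
      map_add' := fun x y => by simp [add_smul]; ring
      map_smul' := fun c x => by simp [mul_assoc]
      invFun := fun v => (planeDet v b / planeDet a b, planeDet a v / planeDet a b)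
      left_inv := fun x => by
        ext <;> simp <;> field_simp <;> simp [planeDet] <;> ring
      right_inv := fun v => by
        simpa using (planeDet_smul_add (v := v) h).symm }

theorem planeEquiv_apply {a b : ℂ} (h : planeDet a b ≠ 0) (x : ℝ × ℝ) :
    planeEquiv a b h x = x.1 • a + x.2 • b := rfl

theorem hasStrictFDerivAt_sum {α β : ℝ → ℂ} (hα : ContDiff ℝ 1 α) (hβ : ContDiff ℝ 1 β) (p : ℂ)
    (x : ℝ × ℝ) (h : planeDet (deriv α x.1) (deriv β x.2) ≠ 0) :
    HasStrictFDerivAt (fun y : ℝ × ℝ => α y.1 + β y.2 - p)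
      (planeEquiv _ _ h : (ℝ × ℝ) →L[ℝ] ℂ) x := by
  have h1 : HasStrictFDerivAt (fun y : ℝ × ℝ => α y.1)
      ((ContinuousLinearMap.toSpanSingleton ℝ (deriv α x.1)).comp
        (ContinuousLinearMap.fst ℝ ℝ ℝ)) x :=
    HasStrictFDerivAt.comp x
      ((hα.contDiffAt.hasStrictDerivAt one_ne_zero).hasStrictFDerivAt) hasStrictFDerivAt_fst
  have h2 : HasStrictFDerivAt (fun y : ℝ × ℝ => β y.2)
      ((ContinuousLinearMap.toSpanSingleton ℝ (deriv β x.2)).comp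
        (ContinuousLinearMap.snd ℝ ℝ ℝ)) x :=
    HasStrictFDerivAt.comp x
      ((hβ.contDiffAt.hasStrictDerivAt one_ne_zero).hasStrictFDerivAt) hasStrictFDerivAt_snd
  refine ((h1.add h2).sub_const p).congr_fderiv ?_
  ext <;> simp [planeEquiv_apply]

/-- A chart of the plane near `p` whose axes are two transverse curves through `p`. -/
structure CrossChart (α β : ℝ → ℂ) (p : ℂ) (σ : ℤˣ) (r : ℝ) where
  smooth_fst : ContDiff ℝ 1 α
  smooth_snd : ContDiff ℝ 1 β
  fst_zero : α 0 = p
  snd_zero : β 0 = p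
  pos : 0 < r
  toHomeo : OpenPartialHomeomorph (ℝ × ℝ) ℂ
  coe_eq : ∀ x, toHomeo x = α x.1 + β x.2 - p
  ball_subset : Metric.ball 0 r ⊆ toHomeo.source
  det_pos : ∀ x ∈ Metric.ball (0 : ℝ × ℝ) r, 0 < ((σ : ℤ) : ℝ) * planeDet (deriv α x.1) (deriv β x.2)

namespace CrossChart

variable {α β : ℝ → ℂ} {p : ℂ} {σ : ℤˣ} {r : ℝ}

/-- Inverse function theorem for `(x, y) ↦ α x + β y - p`. The determinant keeps its sign `σ` on a
small box by continuity. -/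
theorem exists_chart (hα : ContDiff ℝ 1 α) (hβ : ContDiff ℝ 1 β) (hα0 : α 0 = p) (hβ0 : β 0 = p)
    (h : 0 < ((σ : ℤ) : ℝ) * planeDet (deriv α 0) (deriv β 0)) :
    ∃ r, Nonempty (CrossChart α β p σ r) := by
  have hne : planeDet (deriv α (0 : ℝ × ℝ).1) (deriv β (0 : ℝ × ℝ).2) ≠ 0 := by
    intro h0
    simp only [Prod.fst_zero, Prod.snd_zero] at h0
    simp [h0] at h
  have hs := hasStrictFDerivAt_sum hα hβ p 0 hne
  let e := hs.toOpenPartialHomeomorph _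
  have he : (e : ℝ × ℝ → ℂ) = _ := hs.toOpenPartialHomeomorph_coe
  have hmem : (0 : ℝ × ℝ) ∈ e.source := hs.mem_toOpenPartialHomeomorph_source
  have hc : Continuous fun x : ℝ × ℝ =>
      ((σ : ℤ) : ℝ) * planeDet (deriv α x.1) (deriv β x.2) := by
    have h1 := hα.continuous_deriv le_rfl
    have h2 := hβ.continuous_deriv le_rfl
    exact continuous_const.mul
      (continuous_planeDet.comp ((h1.comp continuous_fst).prodMk (h2.comp continuous_snd)))
  have h1 : ∀ᶠ x in 𝓝 (0 : ℝ × ℝ), x ∈ e.source ∧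
      0 < ((σ : ℤ) : ℝ) * planeDet (deriv α x.1) (deriv β x.2) :=
    Filter.Eventually.and (e.open_source.mem_nhds hmem)
      (hc.continuousAt.eventually_const_lt (by simpa using h))
  obtain ⟨r, hr, hsub⟩ := Metric.eventually_nhds_iff_ball.1 h1
  exact ⟨r, ⟨⟨hα, hβ, hα0, hβ0, hr, e, fun x => by rw [he], fun x hx => (hsub x hx).1,
    fun x hx => (hsub x hx).2⟩⟩⟩

/-- The restriction of a chart to a smaller box. -/
def restrict (C : CrossChart α β p σ r) {s : ℝ} (hs : 0 < s) (hsr : s ≤ r) :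
    CrossChart α β p σ s :=
  { C with
    pos := hs
    ball_subset := (Metric.ball_subset_ball hsr).trans C.ball_subset
    det_pos := fun x hx => C.det_pos x (Metric.ball_subset_ball hsr hx) }

theorem injOn (C : CrossChart α β p σ r) : Set.InjOn C.toHomeo (Metric.ball 0 r) :=
  C.toHomeo.injOn.mono C.ball_subset

theorem map_zero (C : CrossChart α β p σ r) : C.toHomeo 0 = p := by
  simp [C.coe_eq, C.fst_zero, C.snd_zero]

theorem image_mem_nhds (C : CrossChart α β p σ r) {U : Set (ℝ × ℝ)} (hU : U ∈ 𝓝 (0 : ℝ × ℝ)) :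
    C.toHomeo '' U ∈ 𝓝 p := by
  have := C.toHomeo.image_mem_nhds (C.ball_subset (Metric.mem_ball_self C.pos)) hU
  rwa [C.map_zero] at this

/-- By Cramer's rule, the first-order change of the chart coordinates in direction `v` is a quotient
of determinants whose denominator has sign `σ`. A nonzero first-order term decides on which side of
each coordinate line the moved point lies. -/
theorem eventually_direction (C : CrossChart α β p σ r) {x : ℝ × ℝ} (hx : x ∈ Metric.ball 0 r)
    (v : ℂ) {ρ : ℝ} (hρ : 0 < ρ) :
    ∀ᶠ ε : ℝ in 𝓝[>] 0, ∃ y ∈ Metric.ball (0 : ℝ × ℝ) r, C.toHomeo y = C.toHomeo x + ε * v ∧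
      |y.1 - x.1| < ρ ∧ |y.2 - x.2| < ρ ∧
      (∀ η : ℤˣ, 0 < ((η : ℤ) : ℝ) * (((σ : ℤ) : ℝ) * planeDet v (deriv β x.2)) →
        0 < ((η : ℤ) : ℝ) * (y.1 - x.1)) ∧
      (∀ η : ℤˣ, 0 < ((η : ℤ) : ℝ) * (((σ : ℤ) : ℝ) * planeDet (deriv α x.1) v) →
        0 < ((η : ℤ) : ℝ) * (y.2 - x.2)) := by
  have hd := C.det_pos x hx
  have hne : planeDet (deriv α x.1) (deriv β x.2) ≠ 0 := by
    intro h0; simp [h0] at hd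
  have hs : HasStrictFDerivAt C.toHomeo (planeEquiv _ _ hne : (ℝ × ℝ) →L[ℝ] ℂ) x := by
    have h1 := hasStrictFDerivAt_sum C.smooth_fst C.smooth_snd p x hne
    have h2 : (C.toHomeo : ℝ × ℝ → ℂ) = fun y => α y.1 + β y.2 - p := funext C.coe_eq
    rwa [h2]
  have hxs := C.ball_subset hx
  have hsymm : HasFDerivAt C.toHomeo.symm
      ((planeEquiv _ _ hne).symm : ℂ →L[ℝ] (ℝ × ℝ)) (C.toHomeo x) := by
    apply C.toHomeo.hasFDerivAt_symm (C.toHomeo.map_source hxs)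
    rw [C.toHomeo.left_inv hxs]
    exact hs.hasFDerivAt
  have hl : HasDerivAt (fun ε : ℝ => C.toHomeo x + ε * v) v 0 := by
    have := ((Complex.ofRealCLM.hasDerivAt (x := (0 : ℝ))).mul_const v).const_add (C.toHomeo x)
    simpa using this
  have hsymm' : HasFDerivAt C.toHomeo.symm
      ((planeEquiv _ _ hne).symm : ℂ →L[ℝ] (ℝ × ℝ)) ((fun ε : ℝ => C.toHomeo x + ε * v) 0) := by
    simpa using hsymm
  have hg := hsymm'.comp_hasDerivAt (0 : ℝ) hl
  set g : ℝ → ℝ × ℝ := C.toHomeo.symm ∘ fun ε : ℝ => C.toHomeo x + ε * v with hgdef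
  have hg0 : g 0 = x := by simp [hgdef, C.toHomeo.left_inv hxs]
  have hg1 : HasDerivAt (fun ε => (g ε).1)
      (planeDet v (deriv β x.2) / planeDet (deriv α x.1) (deriv β x.2)) 0 :=
    (ContinuousLinearMap.fst ℝ ℝ ℝ).hasFDerivAt.comp_hasDerivAt 0 hg
  have hg2 : HasDerivAt (fun ε => (g ε).2)
      (planeDet (deriv α x.1) v / planeDet (deriv α x.1) (deriv β x.2)) 0 :=
    (ContinuousLinearMap.snd ℝ ℝ ℝ).hasFDerivAt.comp_hasDerivAt 0 hg
  have key : ∀ (f : ℝ → ℝ) (m : ℝ), HasDerivAt f m 0 → ∀ η : ℤˣ,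
      (0 < ((η : ℤ) : ℝ) * m) → ∀ᶠ ε : ℝ in 𝓝[>] 0, 0 < ((η : ℤ) : ℝ) * (f ε - f 0) := by
    intro f m hf η hm
    have h1 := hf.const_mul ((η : ℤ) : ℝ)
    have h2 := h1.tendsto_slope_zero_right
    filter_upwards [h2.eventually_const_lt hm, self_mem_nhdsWithin] with ε h3 h4
    have h4' : (0 : ℝ) < ε := h4
    simp only [zero_add, smul_eq_mul, ← mul_sub] at h3
    exact (pos_iff_pos_of_mul_pos h3).1 (inv_pos.2 h4')
  have key' : ∀ (f : ℝ → ℝ) (m : ℝ), HasDerivAt f (m / planeDet (deriv α x.1) (deriv β x.2)) 0 →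
      ∀ᶠ ε : ℝ in 𝓝[>] 0, ∀ η : ℤˣ, (0 < ((η : ℤ) : ℝ) * (((σ : ℤ) : ℝ) * m)) →
        0 < ((η : ℤ) : ℝ) * (f ε - f 0) := by
    intro f m hf
    rw [Filter.eventually_all]
    intro η
    rw [Filter.eventually_imp_distrib_left]
    intro hm
    apply key f _ hf η
    -- Since `σ ^ 2 = 1`, the fraction can be expanded by `σ`, which makes its denominator positive.
    have h1 : ((η : ℤ) : ℝ) * (m / planeDet (deriv α x.1) (deriv β x.2)) =
        ((η : ℤ) : ℝ) * (((σ : ℤ) : ℝ) * m) /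
          (((σ : ℤ) : ℝ) * planeDet (deriv α x.1) (deriv β x.2)) := by
      rcases Int.units_eq_one_or σ with h | h <;> simp [h] <;> ring
    rw [h1]
    positivity
  have hcont : ContinuousAt g 0 := hg.continuousAt
  have hb : ∀ᶠ ε : ℝ in 𝓝[>] 0, g ε ∈ Metric.ball (0 : ℝ × ℝ) r ∧ g ε ∈ Metric.ball x ρ := by
    apply nhdsWithin_le_nhds
    refine hcont.eventually (p := fun y => y ∈ Metric.ball (0 : ℝ × ℝ) r ∧ y ∈ Metric.ball x ρ) ?_
    rw [hg0]
    exact Filter.Eventually.and (Metric.isOpen_ball.mem_nhds hx) (Metric.ball_mem_nhds x hρ)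
  have ht : ∀ᶠ ε : ℝ in 𝓝[>] 0, C.toHomeo x + ε * v ∈ C.toHomeo.target := by
    apply nhdsWithin_le_nhds
    refine hl.continuousAt.eventually (p := fun z => z ∈ C.toHomeo.target) ?_
    apply C.toHomeo.open_target.mem_nhds
    simpa using C.toHomeo.map_source hxs
  filter_upwards [hb, ht, key' _ _ hg1, key' _ _ hg2] with ε h1 h2 h3 h4
  have hdist : max |(g ε).1 - x.1| |(g ε).2 - x.2| < ρ := by
    simpa [Prod.dist_eq, Real.dist_eq] using h1.2
  refine ⟨g ε, h1.1, C.toHomeo.right_inv h2, (max_lt_iff.1 hdist).1, (max_lt_iff.1 hdist).2,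
    ?_, ?_⟩
  · simpa only [hg0] using h3
  · simpa only [hg0] using h4

end CrossChart

/-! ### Cauchy integrals along plane arcs and their jumps -/

/-- The Cauchy integral of a constant density along an arc of a plane curve. -/
noncomputable def cauchyIntegral (γ : ℝ → ℂ) (a b : ℝ) (z : ℂ) : ℂ :=
  ∫ t in a..b, deriv γ t / (γ t - z)

section

variable {γ : ℝ → ℂ} {a b : ℝ} {z : ℂ}

theorem exists_dist_lt_of_notMem_image {γ : ℝ → ℂ} (hγ : Continuous γ) {a b : ℝ} {z : ℂ}
    (hz : ∀ t ∈ Set.Icc a b, γ t ≠ z) :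
    ∃ δ > 0, ∀ w ∈ Metric.ball z δ, ∀ t ∈ Set.Icc a b, δ ≤ ‖γ t - w‖ := by
  have hc : IsClosed (γ '' Set.Icc a b) := (isCompact_Icc.image hγ).isClosed
  have hn : (γ '' Set.Icc a b)ᶜ ∈ 𝓝 z :=
    hc.isOpen_compl.mem_nhds (by rintro ⟨t, ht, h⟩; exact hz t ht h)
  obtain ⟨r, hr, hsub⟩ := Metric.mem_nhds_iff.1 hn
  refine ⟨r / 2, half_pos hr, fun w hw t ht => ?_⟩
  by_contra! hlt
  refine hsub (?_ : γ t ∈ Metric.ball z r) ⟨t, ht, rfl⟩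
  rw [Metric.mem_ball] at hw ⊢
  have : dist (γ t) w < r / 2 := by rwa [dist_eq_norm]
  linarith [dist_triangle (γ t) w z]

/-- Differentiation under the integral produces `γ' / (γ - z) ^ 2`, the exact derivative of `-(γ -
z)⁻¹`. Only endpoint terms remain, and these can cancel between several arcs. -/
theorem hasDerivAt_cauchyIntegral (hγ : ContDiff ℝ 1 γ) (hab : a ≤ b)
    (hz : ∀ t ∈ Set.Icc a b, γ t ≠ z) :
    HasDerivAt (cauchyIntegral γ a b) ((γ a - z)⁻¹ - (γ b - z)⁻¹) z := by
  obtain ⟨δ, hδ, hlow⟩ := exists_dist_lt_of_notMem_image hγ.continuous hz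
  have hγ' : Continuous (deriv γ) := hγ.continuous_deriv le_rfl
  have hne : ∀ w ∈ Metric.ball z δ, ∀ t ∈ Set.Icc a b, γ t - w ≠ 0 := fun w hw t ht h => by
    have := hlow w hw t ht
    rw [h, norm_zero] at this
    linarith
  have hcont : ∀ w ∈ Metric.ball z δ,
      ContinuousOn (fun t => deriv γ t / (γ t - w)) (Set.Icc a b) := fun w hw =>
    hγ'.continuousOn.div (hγ.continuous.sub continuous_const).continuousOn (hne w hw)
  have hcont2 : ContinuousOn (fun t => deriv γ t / (γ t - z) ^ 2) (Set.Icc a b) :=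
    hγ'.continuousOn.div ((hγ.continuous.sub continuous_const).pow 2).continuousOn
      fun t ht => pow_ne_zero 2 (hne z (Metric.mem_ball_self hδ) t ht)
  have huIcc : Set.uIcc a b = Set.Icc a b := Set.uIcc_of_le hab
  have hsub : Set.uIoc a b ⊆ Set.Icc a b := by
    rw [Set.uIoc_of_le hab]; exact Set.Ioc_subset_Icc_self
  have key := (intervalIntegral.hasDerivAt_integral_of_dominated_loc_of_deriv_le
    (μ := MeasureTheory.volume) (a := a) (b := b)
    (F := fun w t => deriv γ t / (γ t - w)) (F' := fun w t => deriv γ t / (γ t - w) ^ 2)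
    (bound := fun t => ‖deriv γ t‖ / δ ^ 2) (Metric.ball_mem_nhds z hδ) ?_ ?_ ?_ ?_ ?_ ?_).2
  · have h1 : ∫ t in a..b, deriv γ t / (γ t - z) ^ 2 = (γ a - z)⁻¹ - (γ b - z)⁻¹ := by
      rw [intervalIntegral.integral_eq_sub_of_hasDerivAt (f := fun t => -(γ t - z)⁻¹)]
      · ring
      · intro t ht
        rw [huIcc] at ht
        have h2 : HasDerivAt (fun t => γ t - z) (deriv γ t) t :=
          ((hγ.differentiable one_ne_zero t).hasDerivAt).sub_const z
        have := (h2.inv (hne z (Metric.mem_ball_self hδ) t ht)).neg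
        exact this.congr_deriv (by ring)
      · exact ContinuousOn.intervalIntegrable (by rwa [huIcc])
    rw [h1] at key
    exact key
  · filter_upwards [Metric.ball_mem_nhds z hδ] with w hw
    exact ((hcont w hw).mono hsub).aestronglyMeasurable measurableSet_uIoc
  · exact ContinuousOn.intervalIntegrable (by rw [huIcc]; exact hcont z (Metric.mem_ball_self hδ))
  · exact (hcont2.mono hsub).aestronglyMeasurable measurableSet_uIoc
  · refine Filter.Eventually.of_forall fun t ht w hw => ?_
    rw [norm_div, norm_pow]
    gcongr
    exact hlow w hw t (hsub ht)
  · exact (hγ'.norm.div_const _).intervalIntegrable _ _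
  · refine Filter.Eventually.of_forall fun t ht w hw => ?_
    have h2 : HasDerivAt (fun w => γ t - w) (-1) w := by
      simpa using (hasDerivAt_id w).const_sub (γ t)
    have := (h2.inv (hne w hw t (hsub ht))).const_mul (deriv γ t)
    simpa [div_eq_mul_inv] using this

theorem tendsto_sub_of_continuousAt {f : ℂ → ℂ} {p : ℂ} (hf : ContinuousAt f p) (v : ℂ) :
    Filter.Tendsto (fun ε : ℝ => f (p + ε * v) - f (p - ε * v)) (𝓝[>] 0) (𝓝 0) := by
  have h1 : Filter.Tendsto (fun ε : ℝ => p + ε * v) (𝓝[>] 0) (𝓝 p) := by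
    have : Continuous fun ε : ℝ => p + ε * v := by fun_prop
    simpa using (this.tendsto 0).mono_left nhdsWithin_le_nhds
  have h2 : Filter.Tendsto (fun ε : ℝ => p - ε * v) (𝓝[>] 0) (𝓝 p) := by
    have : Continuous fun ε : ℝ => p - ε * v := by fun_prop
    simpa using (this.tendsto 0).mono_left nhdsWithin_le_nhds
  simpa using (hf.tendsto.comp h1).sub (hf.tendsto.comp h2)

/-- Here `w` is the rescaled curve, a perturbation of its tangent line. The bound supplies the
integrable majorant `(1 + s ^ 2)⁻¹` and keeps `w` away from `±i`. -/
theorem half_one_add_sq_le_norm {s : ℝ} {w : ℂ} (h : ‖w - s‖ ≤ |s| / 10) :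
    (1 + s ^ 2) / 2 ≤ ‖w ^ 2 + 1‖ := by
  have h1 : |w.re - s| ≤ |s| / 10 := by
    simpa using (Complex.abs_re_le_norm (w - s)).trans h
  have h2 : |w.im| ≤ |s| / 10 := by
    simpa using (Complex.abs_im_le_norm (w - s)).trans h
  have h3 : w.im ^ 2 ≤ (|s| / 10) ^ 2 := by
    rw [← sq_abs w.im]; gcongr
  have h4 : (w ^ 2 + 1).re = w.re ^ 2 - w.im ^ 2 + 1 := by
    simp [sq]
  refine le_trans ?_ ((le_abs_self _).trans (Complex.abs_re_le_norm _))
  rw [h4]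
  have h5 : (|s| - |s| / 10) ^ 2 ≤ w.re ^ 2 := by
    rw [← sq_abs w.re]
    have : |s| - |s| / 10 ≤ |w.re| := by
      have := abs_sub_abs_le_abs_sub s w.re
      rw [abs_sub_comm] at this
      linarith
    have h0 : 0 ≤ |s| - |s| / 10 := by linarith [abs_nonneg s]
    gcongr
  have h6 := sq_abs s
  nlinarith

/-- The jump of the Cauchy integral across a short arc. -/
theorem exists_tendsto_cauchyIntegral_jump (hγ : ContDiff ℝ 1 γ) {t₀ : ℝ} (h0 : deriv γ t₀ ≠ 0)
    {r₀ : ℝ} (hr₀ : 0 < r₀) :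
    ∃ r, 0 < r ∧ r ≤ r₀ ∧ Filter.Tendsto (fun ε : ℝ =>
      cauchyIntegral γ (t₀ - r) (t₀ + r) (γ t₀ + ε * (Complex.I * deriv γ t₀)) -
        cauchyIntegral γ (t₀ - r) (t₀ + r) (γ t₀ - ε * (Complex.I * deriv γ t₀)))
      (𝓝[>] 0) (𝓝 (2 * Real.pi * Complex.I)) := by
  set a := deriv γ t₀ with ha
  have hapos : 0 < ‖a‖ := norm_pos_iff.2 h0
  have hγ' : Continuous (deriv γ) := hγ.continuous_deriv le_rfl
  have hd : HasDerivAt γ a t₀ := (hγ.differentiable one_ne_zero t₀).hasDerivAt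
  -- After division by `ε * a` the factor `1 / 10` is the tolerance in `half_one_add_sq_le_norm`.
  have hlin : ∀ᶠ t in 𝓝 t₀, ‖γ t - γ t₀ - (t - t₀) • a‖ ≤ ‖a‖ / 10 * ‖t - t₀‖ :=
    (hasDerivAt_iff_isLittleO.1 hd).def (by positivity)
  obtain ⟨r₁, hr₁, hlin⟩ := Metric.eventually_nhds_iff.1 hlin
  set r := min r₀ (r₁ / 2) with hr
  have hrpos : 0 < r := lt_min hr₀ (half_pos hr₁)
  have hlin' : ∀ t, |t - t₀| ≤ r → ‖γ t - γ t₀ - (t - t₀) • a‖ ≤ ‖a‖ / 10 * |t - t₀| := by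
    intro t ht
    refine hlin ?_
    rw [Real.dist_eq]
    linarith [min_le_right r₀ (r₁ / 2)]
  obtain ⟨M, hM⟩ : ∃ M, ∀ t ∈ Set.Icc (t₀ - r) (t₀ + r), ‖deriv γ t‖ ≤ M :=
    isCompact_Icc.exists_bound_of_continuousOn hγ'.continuousOn
  refine ⟨r, hrpos, min_le_left _ _, ?_⟩
  -- Blow-up at `γ t₀`: with `t = t₀ + ε * s` the displacement is measured in units of `ε * a`, so
  -- `d ε s` tends to `s` and the two evaluation points become `i` and `-i`.
  set d : ℝ → ℝ → ℂ := fun ε s => (γ (t₀ + ε * s) - γ t₀) / (ε * a) with hdd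
  have hd1 : ∀ ε s : ℝ, 0 < ε → |ε * s| ≤ r → (1 + s ^ 2) / 2 ≤ ‖d ε s ^ 2 + 1‖ := by
    intro ε s hε hs
    apply half_one_add_sq_le_norm
    have h1 := hlin' (t₀ + ε * s) (by simpa using hs)
    have hεa : (ε : ℂ) * a ≠ 0 := mul_ne_zero (by exact_mod_cast hε.ne') h0
    have h2 : d ε s - s = (γ (t₀ + ε * s) - γ t₀ - (t₀ + ε * s - t₀) • a) / (ε * a) := by
      rw [eq_div_iff hεa, sub_mul, hdd]
      simp only
      rw [div_mul_cancel₀ _ hεa]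
      simp
      ring
    rw [h2, norm_div, div_le_iff₀ (norm_pos_iff.2 hεa), norm_mul, Complex.norm_real,
      Real.norm_eq_abs]
    refine h1.trans (le_of_eq ?_)
    rw [add_sub_cancel_left, abs_mul]
    ring
  have hne : ∀ ε s : ℝ, 0 < ε → |ε * s| ≤ r →
      d ε s ^ 2 + 1 ≠ 0 ∧ γ (t₀ + ε * s) - (γ t₀ + ε * (Complex.I * a)) ≠ 0 ∧
        γ (t₀ + ε * s) - (γ t₀ - ε * (Complex.I * a)) ≠ 0 := by
    intro ε s hε hs
    have h1 : d ε s ^ 2 + 1 ≠ 0 := by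
      have := hd1 ε s hε hs
      intro h
      rw [h, norm_zero] at this
      nlinarith [sq_nonneg s]
    have hεa : (ε : ℂ) * a ≠ 0 := mul_ne_zero (by exact_mod_cast hε.ne') h0
    have h3 : d ε s * (ε * a) = γ (t₀ + ε * s) - γ t₀ := div_mul_cancel₀ _ hεa
    -- The two Cauchy denominators multiply to `(ε * a) ^ 2 * (d ^ 2 + 1)`, so the one lower bound
    -- shows that neither vanishes.
    have h2 : (γ (t₀ + ε * s) - (γ t₀ + ε * (Complex.I * a))) *
        (γ (t₀ + ε * s) - (γ t₀ - ε * (Complex.I * a))) = (ε * a) ^ 2 * (d ε s ^ 2 + 1) := by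
      linear_combination (-(γ (t₀ + ε * s) - γ t₀) - d ε s * (ε * a)) * h3 -
        (ε * a) ^ 2 * Complex.I_sq
    have h4 := mul_ne_zero (pow_ne_zero 2 hεa) h1
    rw [← h2] at h4
    exact ⟨h1, left_ne_zero_of_mul h4, right_ne_zero_of_mul h4⟩
  set G : ℝ → ℝ → ℂ := fun ε s => deriv γ (t₀ + ε * s) / a * (2 * Complex.I / (d ε s ^ 2 + 1))
    with hG
  have hdcont : ∀ ε, Continuous (d ε) := fun ε =>
    ((hγ.continuous.comp (continuous_const.add (continuous_const.mul continuous_id))).sub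
      continuous_const).div_const _
  have hGcont : ∀ ε : ℝ, 0 < ε → ContinuousOn (G ε) {s | |ε * s| ≤ r} := by
    intro ε hε
    refine ContinuousOn.mul (Continuous.continuousOn ?_) ?_
    · exact (hγ'.comp (continuous_const.add (continuous_const.mul continuous_id))).div_const _
    · exact continuousOn_const.div (((hdcont ε).pow 2).add continuous_const).continuousOn
        fun s hs => (hne ε s hε hs).1
  have hmem : ∀ ε s : ℝ, 0 < ε → s ∈ Set.Ioc (-(r / ε)) (r / ε) → |ε * s| ≤ r := by
    intro ε s hε hs
    rw [abs_mul, abs_of_pos hε, ← le_div_iff₀' hε, abs_le]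
    exact ⟨hs.1.le, hs.2⟩
  have heq : ∀ ε : ℝ, 0 < ε →
      cauchyIntegral γ (t₀ - r) (t₀ + r) (γ t₀ + ε * (Complex.I * a)) -
        cauchyIntegral γ (t₀ - r) (t₀ + r) (γ t₀ - ε * (Complex.I * a)) =
      ∫ s, (Set.Ioc (-(r / ε)) (r / ε)).indicator (G ε) s := by
    intro ε hε
    have hint : ∀ w : ℂ, (∀ s, |ε * s| ≤ r → γ (t₀ + ε * s) - w ≠ 0) →
        IntervalIntegrable (fun t => deriv γ t / (γ t - w)) MeasureTheory.volume
          (t₀ - r) (t₀ + r) := by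
      intro w hw
      apply ContinuousOn.intervalIntegrable
      refine hγ'.continuousOn.div (hγ.continuous.sub continuous_const).continuousOn ?_
      intro t ht
      rw [Set.uIcc_of_le (by linarith)] at ht
      have h1 : t₀ + ε * ((t - t₀) / ε) = t := by field_simp; ring
      have := hw ((t - t₀) / ε) (by
        rw [mul_div_cancel₀ _ hε.ne', abs_le]
        constructor <;> linarith [ht.1, ht.2])
      rwa [h1] at this
    rw [cauchyIntegral, cauchyIntegral, ← intervalIntegral.integral_sub
      (hint _ fun s hs => (hne ε s hε hs).2.1) (hint _ fun s hs => (hne ε s hε hs).2.2)]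
    have hle : -(r / ε) ≤ r / ε := by
      have : 0 < r / ε := by positivity
      linarith
    rw [MeasureTheory.integral_indicator measurableSet_Ioc,
      ← intervalIntegral.integral_of_le hle]
    have h1 : t₀ - r = t₀ + ε * -(r / ε) := by field_simp; ring
    have h2 : t₀ + r = t₀ + ε * (r / ε) := by field_simp
    rw [h1, h2, ← intervalIntegral.smul_integral_comp_add_mul, ← intervalIntegral.integral_smul]
    apply intervalIntegral.integral_congr_ae
    refine Filter.Eventually.of_forall fun s hs => ?_
    rw [Set.uIoc_of_le hle] at hs
    obtain ⟨n1, n2, n3⟩ := hne ε s hε (hmem ε s hε hs)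
    have hεa : (ε : ℂ) * a ≠ 0 := mul_ne_zero (by exact_mod_cast hε.ne') h0
    have h3 : γ (t₀ + ε * s) = γ t₀ + d ε s * (ε * a) := by
      rw [hdd]; simp only; rw [div_mul_cancel₀ _ hεa]; ring
    have h4 : ((ε : ℂ) * a) ^ 2 * (d ε s ^ 2 + 1) =
        (γ (t₀ + ε * s) - (γ t₀ + ε * (Complex.I * a))) *
        (γ (t₀ + ε * s) - (γ t₀ - ε * (Complex.I * a))) := by
      rw [h3]
      linear_combination (ε * a) ^ 2 * Complex.I_sq
    have h5 : 2 * Complex.I / (d ε s ^ 2 + 1) = 2 * Complex.I * (ε * a) ^ 2 /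
        ((γ (t₀ + ε * s) - (γ t₀ + ε * (Complex.I * a))) *
        (γ (t₀ + ε * s) - (γ t₀ - ε * (Complex.I * a)))) := by
      rw [← h4, mul_comm (2 * Complex.I), mul_div_mul_left _ _ (pow_ne_zero 2 hεa)]
    simp only [hG]
    rw [h5, Complex.real_smul, div_sub_div _ _ n2 n3, ← mul_div_assoc, div_mul_div_comm,
      div_eq_div_iff (mul_ne_zero n2 n3) (mul_ne_zero h0 (mul_ne_zero n2 n3))]
    ring
  -- Dominated convergence: the rescaled integrand tends to `2i / (1 + s ^ 2)` on a window growing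
  -- to the whole line, and the limit integral is `2πi`.
  have hlim : Filter.Tendsto (fun ε => ∫ s, (Set.Ioc (-(r / ε)) (r / ε)).indicator (G ε) s)
      (𝓝[>] 0) (𝓝 (∫ s : ℝ, ((2 * (1 + s ^ 2)⁻¹ : ℝ) : ℂ) * Complex.I)) := by
    refine MeasureTheory.tendsto_integral_filter_of_dominated_convergence
      (fun s => M / ‖a‖ * (4 * (1 + s ^ 2)⁻¹)) ?_ ?_ ?_ ?_
    · filter_upwards [self_mem_nhdsWithin] with ε hε
      rw [aestronglyMeasurable_indicator_iff measurableSet_Ioc]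
      exact ((hGcont ε hε).mono fun s hs => hmem ε s hε hs).aestronglyMeasurable
        measurableSet_Ioc
    · filter_upwards [self_mem_nhdsWithin] with ε hε
      refine Filter.Eventually.of_forall fun s => ?_
      have hM0 : 0 ≤ M := (norm_nonneg _).trans (hM t₀ ⟨by linarith, by linarith⟩)
      by_cases hs : s ∈ Set.Ioc (-(r / ε)) (r / ε)
      · rw [Set.indicator_of_mem hs]
        have h1 := hmem ε s hε hs
        simp only [hG, norm_mul, norm_div]
        have h2 := hd1 ε s hε h1
        have h3 : 0 < 1 + s ^ 2 := by positivity
        have h4 := hM (t₀ + ε * s) ⟨by linarith [(abs_le.1 h1).1], by linarith [(abs_le.1 h1).2]⟩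
        have h5 : ‖(2 : ℂ)‖ * ‖Complex.I‖ / ‖d ε s ^ 2 + 1‖ ≤ 4 * (1 + s ^ 2)⁻¹ := by
          rw [Complex.norm_I, mul_one, Complex.norm_ofNat]
          calc (2 : ℝ) / ‖d ε s ^ 2 + 1‖ ≤ 2 / ((1 + s ^ 2) / 2) := by gcongr
            _ = 4 * (1 + s ^ 2)⁻¹ := by field_simp; norm_num
        gcongr
      · rw [Set.indicator_of_notMem hs, norm_zero]
        positivity
    · exact (integrable_inv_one_add_sq.const_mul 4).const_mul _
    · refine Filter.Eventually.of_forall fun s => ?_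
      have h1 : Filter.Tendsto (fun ε => d ε s) (𝓝[>] 0) (𝓝 (s : ℂ)) := by
        have h2 : HasDerivAt (fun ε : ℝ => γ (t₀ + ε * s)) (s • a) 0 := by
          have h3 : HasDerivAt (fun ε : ℝ => t₀ + ε * s) s 0 := by
            simpa using ((hasDerivAt_id (0 : ℝ)).mul_const s).const_add t₀
          have h4 : HasDerivAt γ a (t₀ + 0 * s) := by simpa using hd
          exact h4.scomp 0 h3
        have h5 := (h2.tendsto_slope_zero_right).div_const a
        have h6 : s • a / a = (s : ℂ) := by
          rw [Complex.real_smul, mul_div_cancel_right₀ _ h0]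
        rw [h6] at h5
        refine h5.congr fun ε => ?_
        simp [hdd, div_eq_mul_inv]
        ring
      have h2 : Filter.Tendsto (fun ε : ℝ => deriv γ (t₀ + ε * s)) (𝓝[>] 0) (𝓝 a) := by
        have h3 : Continuous fun ε : ℝ => deriv γ (t₀ + ε * s) := by fun_prop
        simpa using (h3.tendsto 0).mono_left nhdsWithin_le_nhds
      have hs0 : (s : ℂ) ^ 2 + 1 ≠ 0 := by
        have : s ^ 2 + 1 ≠ 0 := by positivity
        exact_mod_cast this
      have h3 : Filter.Tendsto (fun ε => G ε s) (𝓝[>] 0)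
          (𝓝 (((2 * (1 + s ^ 2)⁻¹ : ℝ) : ℂ) * Complex.I)) := by
        have := (h2.div_const a).mul
          ((tendsto_const_nhds (x := 2 * Complex.I)).div ((h1.pow 2).add_const 1) hs0)
        have hval : a / a * (2 * Complex.I / ((s : ℂ) ^ 2 + 1)) =
            ((2 * (1 + s ^ 2)⁻¹ : ℝ) : ℂ) * Complex.I := by
          rw [div_self h0]
          push_cast
          rw [add_comm 1 ((s : ℂ) ^ 2)]
          ring
        rw [← hval]
        exact this
      refine h3.congr' ?_
      have h4 : ∀ᶠ ε : ℝ in 𝓝[>] 0, |s| * ε < r := by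
        have h5 : Continuous fun ε : ℝ => |s| * ε := by fun_prop
        have := (h5.tendsto 0).mono_left (nhdsWithin_le_nhds (s := Set.Ioi 0))
        rw [mul_zero] at this
        exact this.eventually_lt_const hrpos
      filter_upwards [h4, self_mem_nhdsWithin] with ε h5 hε
      rw [Set.indicator_of_mem]
      have h6 : |s| < r / ε := (lt_div_iff₀ hε).2 h5
      exact ⟨(abs_lt.1 h6).1, (abs_lt.1 h6).2.le⟩
  have hval : ∫ s : ℝ, ((2 * (1 + s ^ 2)⁻¹ : ℝ) : ℂ) * Complex.I = 2 * Real.pi * Complex.I := by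
    rw [MeasureTheory.integral_mul_const, integral_complex_ofReal, MeasureTheory.integral_const_mul,
      integral_univ_inv_one_add_sq]
    push_cast
    ring
  rw [hval] at hlim
  refine hlim.congr' ?_
  filter_upwards [self_mem_nhdsWithin] with ε hε
  exact (heq ε hε).symm

/-- The Cauchy integral of density one jumps by `2 * π * I` across a simple point of the arc. -/
theorem tendsto_cauchyIntegral_jump (hγ : ContDiff ℝ 1 γ) {t₀ : ℝ} (ha : a < t₀) (hb : t₀ < b)
    (h0 : deriv γ t₀ ≠ 0) (hne : ∀ t ∈ Set.Icc a b, t ≠ t₀ → γ t ≠ γ t₀)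
    (hoff : ∀ᶠ ε : ℝ in 𝓝[>] 0, ∀ t ∈ Set.Icc a b,
      γ t ≠ γ t₀ + ε * (Complex.I * deriv γ t₀) ∧ γ t ≠ γ t₀ - ε * (Complex.I * deriv γ t₀)) :
    Filter.Tendsto (fun ε : ℝ =>
      cauchyIntegral γ a b (γ t₀ + ε * (Complex.I * deriv γ t₀)) -
        cauchyIntegral γ a b (γ t₀ - ε * (Complex.I * deriv γ t₀)))
      (𝓝[>] 0) (𝓝 (2 * Real.pi * Complex.I)) := by
  obtain ⟨r, hr, hrle, hlim⟩ := exists_tendsto_cauchyIntegral_jump hγ h0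
    (r₀ := min (t₀ - a) (b - t₀)) (lt_min (by linarith) (by linarith))
  have hra : a ≤ t₀ - r := by linarith [min_le_left (t₀ - a) (b - t₀)]
  have hrb : t₀ + r ≤ b := by linarith [min_le_right (t₀ - a) (b - t₀)]
  have hγ' : Continuous (deriv γ) := hγ.continuous_deriv le_rfl
  -- The two outer arcs avoid `γ t₀`, so their integrals are continuous there and contribute no
  -- jump.
  have hleft := tendsto_sub_of_continuousAt (hasDerivAt_cauchyIntegral hγ hra (z := γ t₀)
    fun t ht => hne t ⟨ht.1, by linarith [ht.2]⟩
      (by linarith [ht.2] : t < t₀).ne).continuousAt (Complex.I * deriv γ t₀)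
  have hright := tendsto_sub_of_continuousAt (hasDerivAt_cauchyIntegral hγ hrb (z := γ t₀)
    fun t ht => hne t ⟨by linarith [ht.1], ht.2⟩
      (by linarith [ht.1] : t₀ < t).ne').continuousAt (Complex.I * deriv γ t₀)
  have hsum := (hleft.add hlim).add hright
  rw [zero_add, add_zero] at hsum
  have hsplit : ∀ w : ℂ, (∀ t ∈ Set.Icc a b, γ t ≠ w) → cauchyIntegral γ a b w =
      cauchyIntegral γ a (t₀ - r) w + cauchyIntegral γ (t₀ - r) (t₀ + r) w +
        cauchyIntegral γ (t₀ + r) b w := by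
    intro w hw
    have hint : ∀ x ∈ Set.Icc a b, ∀ y ∈ Set.Icc a b,
        IntervalIntegrable (fun t => deriv γ t / (γ t - w)) MeasureTheory.volume x y := by
      intro x hx y hy
      apply ContinuousOn.intervalIntegrable
      exact hγ'.continuousOn.div (hγ.continuous.sub continuous_const).continuousOn fun t ht =>
        sub_ne_zero.2 (hw t (Set.uIcc_subset_Icc hx hy ht))
    have m1 : a ∈ Set.Icc a b := ⟨le_rfl, by linarith⟩
    have m2 : t₀ - r ∈ Set.Icc a b := ⟨hra, by linarith⟩
    have m3 : t₀ + r ∈ Set.Icc a b := ⟨by linarith, hrb⟩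
    have m4 : b ∈ Set.Icc a b := ⟨by linarith, le_rfl⟩
    simp only [cauchyIntegral]
    rw [intervalIntegral.integral_add_adjacent_intervals (hint _ m1 _ m2) (hint _ m2 _ m3),
      intervalIntegral.integral_add_adjacent_intervals (hint _ m1 _ m3) (hint _ m3 _ m4)]
  refine hsum.congr' ?_
  filter_upwards [hoff] with ε hε
  rw [hsplit _ fun t ht => (hε t ht).1, hsplit _ fun t ht => (hε t ht).2]
  ring

end

/-! ### Sides of the axes and quadrants of a chart -/

namespace CrossChart

variable {α β : ℝ → ℂ} {p : ℂ} {σ : ℤˣ} {r : ℝ}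

theorem units_mul_self_real (σ : ℤˣ) : ((σ : ℤ) : ℝ) * ((σ : ℤ) : ℝ) = 1 := by
  rcases Int.units_eq_one_or σ with h | h <;> simp [h]

theorem fst_mem_ball {τ : ℝ} (h : |τ| < r) : ((τ, 0) : ℝ × ℝ) ∈ Metric.ball (0 : ℝ × ℝ) r := by
  simpa [Prod.norm_def] using h

theorem snd_mem_ball {τ : ℝ} (h : |τ| < r) : ((0, τ) : ℝ × ℝ) ∈ Metric.ball (0 : ℝ × ℝ) r := by
  simpa [Prod.norm_def] using h

theorem apply_fst (C : CrossChart α β p σ r) (τ : ℝ) : C.toHomeo (τ, 0) = α τ := by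
  simp [C.coe_eq, C.snd_zero]

theorem apply_snd (C : CrossChart α β p σ r) (τ : ℝ) : C.toHomeo (0, τ) = β τ := by
  simp [C.coe_eq, C.fst_zero]

theorem planeDet_mul_I_pos {a : ℂ} (h : a ≠ 0) : 0 < planeDet a (Complex.I * a) := by
  have := Complex.normSq_pos.2 h
  rw [Complex.normSq_apply] at this
  simp [planeDet]
  linarith

/-- The left normal forms a positive determinant with `α'`, so the left of the first axis is the
half where the second coordinate has sign `σ`. The bound `ρ` later keeps the point in one quadrant.
-/
theorem eventually_sides_fst (C : CrossChart α β p σ r) {τ : ℝ} (hτ : |τ| < r) {ρ : ℝ}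
    (hρ : 0 < ρ) :
    ∀ᶠ ε : ℝ in 𝓝[>] 0,
      (∃ y ∈ Metric.ball (0 : ℝ × ℝ) r, C.toHomeo y = α τ + ε * (Complex.I * deriv α τ) ∧
        |y.1 - τ| < ρ ∧ 0 < ((σ : ℤ) : ℝ) * y.2) ∧
      (∃ y ∈ Metric.ball (0 : ℝ × ℝ) r, C.toHomeo y = α τ - ε * (Complex.I * deriv α τ) ∧
        |y.1 - τ| < ρ ∧ 0 < (((-σ : ℤˣ) : ℤ) : ℝ) * y.2) := by
  have hx := fst_mem_ball hτ
  have h0 : deriv α τ ≠ 0 := by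
    intro h
    have := C.det_pos _ hx
    simp [h, planeDet] at this
  have hpos := planeDet_mul_I_pos h0
  have hneg : planeDet (deriv α τ) (-(Complex.I * deriv α τ)) =
      -planeDet (deriv α τ) (Complex.I * deriv α τ) := by
    simp [planeDet]
    ring
  filter_upwards [C.eventually_direction hx (Complex.I * deriv α τ) hρ,
    C.eventually_direction hx (-(Complex.I * deriv α τ)) hρ] with ε h1 h2
  obtain ⟨y, hy, e, b1, -, -, b2⟩ := h1
  obtain ⟨z, hz, f, c1, -, -, c2⟩ := h2
  rw [apply_fst] at e f
  refine ⟨⟨y, hy, e, b1, ?_⟩, ⟨z, hz, by rw [f]; ring, c1, ?_⟩⟩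
  · have := b2 σ
    rw [← mul_assoc, units_mul_self_real, one_mul] at this
    simpa using this hpos
  · have := c2 (-σ)
    simp only [hneg] at this
    have h3 : (((-σ : ℤˣ) : ℤ) : ℝ) = -((σ : ℤ) : ℝ) := by simp
    rw [h3] at this ⊢
    rw [neg_mul, mul_neg, mul_neg, neg_neg, ← mul_assoc, units_mul_self_real, one_mul] at this
    simpa using this hpos

/-- The signs are opposite to those for the first axis, because the determinant now has the normal
vector in its first slot. -/
theorem eventually_sides_snd (C : CrossChart α β p σ r) {τ : ℝ} (hτ : |τ| < r) {ρ : ℝ}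
    (hρ : 0 < ρ) :
    ∀ᶠ ε : ℝ in 𝓝[>] 0,
      (∃ y ∈ Metric.ball (0 : ℝ × ℝ) r, C.toHomeo y = β τ + ε * (Complex.I * deriv β τ) ∧
        |y.2 - τ| < ρ ∧ 0 < (((-σ : ℤˣ) : ℤ) : ℝ) * y.1) ∧
      (∃ y ∈ Metric.ball (0 : ℝ × ℝ) r, C.toHomeo y = β τ - ε * (Complex.I * deriv β τ) ∧
        |y.2 - τ| < ρ ∧ 0 < ((σ : ℤ) : ℝ) * y.1) := by
  have hx := snd_mem_ball hτ
  have h0 : deriv β τ ≠ 0 := by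
    intro h
    have := C.det_pos _ hx
    simp [h, planeDet] at this
  have hpos := planeDet_mul_I_pos h0
  have hneg : planeDet (Complex.I * deriv β τ) (deriv β τ) =
      -planeDet (deriv β τ) (Complex.I * deriv β τ) := by
    simp [planeDet]
    ring
  have hneg' : planeDet (-(Complex.I * deriv β τ)) (deriv β τ) =
      planeDet (deriv β τ) (Complex.I * deriv β τ) := by
    simp [planeDet]
    ring
  filter_upwards [C.eventually_direction hx (Complex.I * deriv β τ) hρ,
    C.eventually_direction hx (-(Complex.I * deriv β τ)) hρ] with ε h1 h2
  obtain ⟨y, hy, e, -, b1, b2, -⟩ := h1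
  obtain ⟨z, hz, f, -, c1, c2, -⟩ := h2
  rw [apply_snd] at e f
  refine ⟨⟨y, hy, e, b1, ?_⟩, ⟨z, hz, by rw [f]; ring, c1, ?_⟩⟩
  · have := b2 (-σ)
    simp only [hneg] at this
    have h3 : (((-σ : ℤˣ) : ℤ) : ℝ) = -((σ : ℤ) : ℝ) := by simp
    rw [h3] at this ⊢
    rw [neg_mul, mul_neg, mul_neg, neg_neg, ← mul_assoc, units_mul_self_real, one_mul] at this
    simpa using this hpos
  · have := c2 σ
    simp only [hneg'] at this
    rw [← mul_assoc, units_mul_self_real, one_mul] at this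
    simpa using this hpos

/-- An open quadrant of the coordinate box. -/
def quadrant (r : ℝ) (ε δ : ℤˣ) : Set (ℝ × ℝ) :=
  {x | x ∈ Metric.ball 0 r ∧ 0 < ((ε : ℤ) : ℝ) * x.1 ∧ 0 < ((δ : ℤ) : ℝ) * x.2}

/-- An open half of the coordinate box. -/
def halfBox (r : ℝ) (δ : ℤˣ) : Set (ℝ × ℝ) :=
  {x | x ∈ Metric.ball 0 r ∧ 0 < ((δ : ℤ) : ℝ) * x.2}

theorem convex_halfBox (r : ℝ) (δ : ℤˣ) : Convex ℝ (halfBox r δ) := by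
  refine (convex_ball 0 r).inter ?_
  have : IsLinearMap ℝ fun x : ℝ × ℝ => ((δ : ℤ) : ℝ) * x.2 :=
    ⟨fun x y => by simp [mul_add], fun c x => by simp; ring⟩
  exact convex_halfSpace_gt this 0

theorem convex_quadrant (r : ℝ) (ε δ : ℤˣ) : Convex ℝ (quadrant r ε δ) := by
  have h : quadrant r ε δ = halfBox r δ ∩ {x | 0 < ((ε : ℤ) : ℝ) * x.1} := by
    ext x; simp [quadrant, halfBox]; tauto
  rw [h]
  refine (convex_halfBox r δ).inter ?_
  have : IsLinearMap ℝ fun x : ℝ × ℝ => ((ε : ℤ) : ℝ) * x.1 :=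
    ⟨fun x y => by simp [mul_add], fun c x => by simp; ring⟩
  exact convex_halfSpace_gt this 0

theorem quadrant_nonempty {r : ℝ} (hr : 0 < r) (ε δ : ℤˣ) : (quadrant r ε δ).Nonempty := by
  refine ⟨(((ε : ℤ) : ℝ) * (r / 2), ((δ : ℤ) : ℝ) * (r / 2)), ?_, ?_, ?_⟩
  · have h : ∀ ε : ℤˣ, |((ε : ℤ) : ℝ)| = 1 := fun ε => by
      rcases Int.units_eq_one_or ε with h | h <;> simp [h]
    simp [Prod.norm_def, h, abs_of_pos hr, hr]
  · simp only; rw [← mul_assoc, units_mul_self_real]; linarith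
  · simp only; rw [← mul_assoc, units_mul_self_real]; linarith

theorem quadrant_subset_halfBox (r : ℝ) (ε δ : ℤˣ) : quadrant r ε δ ⊆ halfBox r δ :=
  fun _ hx => ⟨hx.1, hx.2.2⟩

theorem isPreconnected_image (C : CrossChart α β p σ r) {S : Set (ℝ × ℝ)} (hS : Convex ℝ S)
    (hr : S ⊆ Metric.ball 0 r) : IsPreconnected (C.toHomeo '' S) :=
  hS.isPreconnected.image _ (C.toHomeo.continuousOn.mono (hr.trans C.ball_subset))

theorem exists_unit_mul_pos {x : ℝ} (hx : x ≠ 0) : ∃ ε : ℤˣ, 0 < ((ε : ℤ) : ℝ) * x := by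
  rcases hx.lt_or_gt with h | h
  · exact ⟨-1, by simpa⟩
  · exact ⟨1, by simpa⟩

end CrossChart

/-! ### Passes through crossings and local charts of a diagram -/

namespace LinkDiagram

variable {l : ℕ} (D : LinkDiagram l)

/-- The projection of a component of the link. -/
def curve (i : Fin l) (t : ℝ) : ℂ := (D.knot i t).1

theorem contDiff_curve (i : Fin l) : ContDiff ℝ 1 (D.curve i) :=
  contDiff_fst.comp ((D.smooth i).of_le (by exact_mod_cast le_top))

theorem continuous_curve (i : Fin l) : Continuous (D.curve i) := (D.contDiff_curve i).continuous

theorem curve_periodic (i : Fin l) : Function.Periodic (D.curve i) 1 := fun t => by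
  simp [curve, D.periodic i t]

theorem curve_add_int (i : Fin l) (t : ℝ) (k : ℤ) : D.curve i (t + k) = D.curve i t := by
  simpa using (D.curve_periodic i).int_mul k t

theorem curve_fract (i : Fin l) (t : ℝ) : D.curve i (Int.fract t) = D.curve i t := by
  rw [← D.curve_add_int i (Int.fract t) ⌊t⌋, Int.fract_add_floor]

theorem deriv_curve_add_int (i : Fin l) (t : ℝ) (k : ℤ) :
    deriv (D.curve i) (t + k) = deriv (D.curve i) t := by
  rw [← deriv_comp_add_const]
  congr 1
  ext s
  exact D.curve_add_int i s k

theorem deriv_curve_ne_zero (i : Fin l) (t : ℝ) : deriv (D.curve i) t ≠ 0 := D.immersed i t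

theorem fract_mem (i : Fin l) (t : ℝ) : (i, Int.fract t) ∈ circlePoints l :=
  ⟨Int.fract_nonneg t, Int.fract_lt_one t⟩

theorem curve_mem_image (i : Fin l) (t : ℝ) : D.curve i t ∈ D.image :=
  ⟨(i, Int.fract t), fract_mem i t, D.curve_fract i t⟩

theorem image_eq : D.image = ⋃ i, D.curve i '' Set.Icc 0 1 := by
  ext z
  simp only [Set.mem_iUnion]
  constructor
  · rintro ⟨⟨i, t⟩, ht, rfl⟩
    exact ⟨i, t, Set.Ico_subset_Icc_self ht, rfl⟩
  · rintro ⟨i, t, -, rfl⟩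
    exact D.curve_mem_image i t

theorem exists_curve_eq {z : ℂ} (hz : z ∈ D.image) : ∃ i t, D.curve i t = z := by
  obtain ⟨⟨i, t⟩, -, rfl⟩ := hz
  exact ⟨i, t, rfl⟩

theorem isCompact_image : IsCompact D.image := by
  rw [image_eq]
  exact isCompact_iUnion fun i => isCompact_Icc.image (D.continuous_curve i)

theorem isOpen_compl_image : IsOpen D.imageᶜ := D.isCompact_image.isClosed.isOpen_compl

/-- The parameter of the pass of the link through a crossing: the overpass or the underpass. -/
def pass (c : D.Crossing) (b : Bool) : Fin l × ℝ := bif b then c.overpass else c.underpass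

variable {D}

theorem pass_mem (c : D.Crossing) (b : Bool) : D.pass c b ∈ circlePoints l := by
  cases b
  · exact c.underpass_mem
  · exact c.overpass_mem

theorem proj_pass (c : D.Crossing) (b : Bool) : D.proj (D.pass c b) = D.proj c.overpass := by
  cases b
  · exact c.proj_eq.symm
  · rfl

theorem overpass_ne_underpass (c : D.Crossing) : c.overpass ≠ c.underpass := fun h => by
  have := c.height_lt
  rw [h] at this
  exact lt_irrefl _ this

theorem eq_pass_of_proj_eq (c : D.Crossing) {q : Fin l × ℝ} (hq : q ∈ circlePoints l)
    (h : D.proj q = D.proj c.overpass) : ∃ b, q = D.pass c b := by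
  rcases D.double q hq c.overpass c.overpass_mem c.underpass c.underpass_mem h c.proj_eq with
    h | h | h
  · exact ⟨true, h⟩
  · exact (overpass_ne_underpass c h).elim
  · exact ⟨false, h⟩

/-- Two crossings over one double point use the same two parameters, and the heights decide which of
them is the overpass. -/
theorem pass_injective {c c' : D.Crossing} {b b' : Bool} (h : D.pass c b = D.pass c' b') :
    c = c' ∧ b = b' := by
  have hp : D.proj c.overpass = D.proj c'.overpass := by
    rw [← proj_pass c b, ← proj_pass c' b', h]
  obtain ⟨b₁, h₁⟩ := eq_pass_of_proj_eq c' c.overpass_mem hp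
  obtain ⟨b₂, h₂⟩ := eq_pass_of_proj_eq c' c.underpass_mem (c.proj_eq ▸ hp)
  have hl := c.height_lt
  have hl' := c'.height_lt
  rcases b₁ with _ | _ <;> rcases b₂ with _ | _ <;> simp only [pass, cond_true, cond_false] at h₁ h₂
  · exact (overpass_ne_underpass c (h₁.trans h₂.symm)).elim
  · rw [h₁, h₂] at hl
    exact (lt_asymm hl hl').elim
  · have hc : c = c' := Crossing.ext h₁ h₂
    subst hc
    refine ⟨rfl, ?_⟩
    rcases b with _ | _ <;> rcases b' with _ | _ <;>
      simp only [pass, cond_true, cond_false] at h ⊢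
    · exact (overpass_ne_underpass c h.symm).elim
    · exact (overpass_ne_underpass c h).elim
  · exact (overpass_ne_underpass c (h₁.trans h₂.symm)).elim

theorem exists_pass_eq {p q : Fin l × ℝ} (hp : p ∈ circlePoints l) (hq : q ∈ circlePoints l)
    (hpq : p ≠ q) (h : D.proj p = D.proj q) : ∃ c b, D.pass c b = p ∧ D.pass c (!b) = q := by
  have hh : D.height p ≠ D.height q := fun hh =>
    hpq (D.embedded hp hq (Prod.ext h hh))
  rcases hh.lt_or_gt with hlt | hlt
  · exact ⟨⟨q, p, hq, hp, h.symm, hlt⟩, false, rfl, rfl⟩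
  · exact ⟨⟨p, q, hp, hq, h, hlt⟩, true, rfl, rfl⟩

variable (D)

/-- A parameter at which the projected link does not pass through a crossing. -/
def IsSimple (i : Fin l) (t : ℝ) : Prop := ∀ c b, D.pass c b ≠ (i, Int.fract t)

variable {D}

theorem IsSimple.eq_of_curve_eq {i j : Fin l} {s t : ℝ} (h : D.IsSimple i t)
    (hc : D.curve j s = D.curve i t) : j = i ∧ ∃ k : ℤ, s = t + k := by
  have hpq : (j, Int.fract s) = (i, Int.fract t) := by
    by_contra hne
    obtain ⟨c, b, -, h2⟩ := exists_pass_eq (D := D) (fract_mem j s) (fract_mem i t) hne (by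
      change D.curve j _ = D.curve i _
      rw [D.curve_fract, D.curve_fract, hc])
    exact h c _ h2
  obtain ⟨h1, h2⟩ := Prod.ext_iff.1 hpq
  obtain ⟨k, hk⟩ := Int.fract_eq_fract.1 h2
  exact ⟨h1, k, by linarith⟩

theorem exists_pass_of_curve_eq (c : D.Crossing) {j : Fin l} {s : ℝ}
    (h : D.curve j s = D.proj c.overpass) :
    ∃ b, j = (D.pass c b).1 ∧ ∃ k : ℤ, s = (D.pass c b).2 + k := by
  obtain ⟨b, hb⟩ := eq_pass_of_proj_eq c (fract_mem j s) (by
    change D.curve j _ = _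
    rw [D.curve_fract, h])
  refine ⟨b, by rw [← hb], ⌊s⌋, ?_⟩
  rw [← hb]
  exact (Int.fract_add_floor s).symm

/-- Within one period the parameters outside `U i` form a compact set whose image is closed and
misses `p`. Hence, near `p`, only the branches through `p` are seen. -/
theorem eventually_parameter_mem {p : ℂ} {U : Fin l → Set ℝ} (hU : ∀ i, IsOpen (U i))
    (hper : ∀ (i : Fin l) (t : ℝ) (k : ℤ), t + k ∈ U i → t ∈ U i) (h : ∀ i t, D.curve i t = p → t ∈ U i) :
    ∀ᶠ z in 𝓝 p, ∀ i t, D.curve i t = z → t ∈ U i := by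
  rw [Filter.eventually_all]
  intro i
  have hc : IsClosed (D.curve i '' (Set.Icc 0 1 \ U i)) :=
    ((isCompact_Icc.diff (hU i)).image (D.continuous_curve i)).isClosed
  have hn : (D.curve i '' (Set.Icc 0 1 \ U i))ᶜ ∈ 𝓝 p :=
    hc.isOpen_compl.mem_nhds (by rintro ⟨t, ht, he⟩; exact ht.2 (h i t he))
  filter_upwards [hn] with z hz t ht
  by_contra hcon
  apply hz
  refine ⟨Int.fract t, ⟨⟨Int.fract_nonneg t, (Int.fract_lt_one t).le⟩, fun hm => hcon ?_⟩, ?_⟩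
  · apply hper i t (-⌊t⌋)
    rwa [Int.fract, sub_eq_add_neg, ← Int.cast_neg] at hm
  · rw [D.curve_fract, ht]

theorem exists_small_box {α β : ℝ → ℂ} {p : ℂ} {σ : ℤˣ} {r : ℝ} (C : CrossChart α β p σ r)
    {P : ℂ → Prop} (hP : ∀ᶠ z in 𝓝 p, P z) :
    ∃ s, 0 < s ∧ s ≤ r ∧ ∀ x ∈ Metric.ball (0 : ℝ × ℝ) s, P (C.toHomeo x) := by
  have h0 : (0 : ℝ × ℝ) ∈ C.toHomeo.source := C.ball_subset (Metric.mem_ball_self C.pos)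
  have hc := C.toHomeo.continuousAt h0
  rw [ContinuousAt, C.map_zero] at hc
  obtain ⟨s, hs, hsub⟩ := Metric.eventually_nhds_iff_ball.1 (hc.eventually hP)
  exact ⟨min s r, lt_min hs C.pos, min_le_right _ _, fun x hx =>
    hsub x (Metric.ball_subset_ball (min_le_left _ _) hx)⟩

theorem isOpen_translates (s r : ℝ) : IsOpen {t : ℝ | ∃ k : ℤ, |t - s - k| < r} := by
  simp only [Set.ofPred_exists]
  exact isOpen_iUnion fun k => isOpen_lt (by fun_prop) continuous_const

theorem contDiff_curve_shift (i : Fin l) (t : ℝ) : ContDiff ℝ 1 fun s => D.curve i (t + s) :=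
  (D.contDiff_curve i).comp (contDiff_const.add contDiff_id)

theorem deriv_curve_shift (i : Fin l) (t s : ℝ) :
    deriv (fun s => D.curve i (t + s)) s = deriv (D.curve i) (t + s) :=
  deriv_comp_const_add (D.curve i) t s

/-- The second axis is the straight normal line. In a small enough box all points of the image come
from the single branch through the centre, and injectivity of the chart puts them on the first axis.
-/
theorem IsSimple.exists_chart {i : Fin l} {t : ℝ} (h : D.IsSimple i t) :
    ∃ r, ∃ C : CrossChart (fun s => D.curve i (t + s))
      (fun s => D.curve i t + s * (Complex.I * deriv (D.curve i) t)) (D.curve i t) 1 r,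
      ∀ x ∈ Metric.ball (0 : ℝ × ℝ) r, C.toHomeo x ∈ D.image → x.2 = 0 := by
  obtain ⟨r, ⟨C⟩⟩ := CrossChart.exists_chart (σ := 1) (p := D.curve i t)
    (contDiff_curve_shift (D := D) i t)
    (β := fun s => D.curve i t + s * (Complex.I * deriv (D.curve i) t))
    (contDiff_const.add (Complex.ofRealCLM.contDiff.mul contDiff_const))
    (by simp) (by simp) (by
      rw [deriv_curve_shift, deriv_const_add]
      have h1 : deriv (fun s : ℝ => (s : ℂ) * (Complex.I * deriv (D.curve i) t)) 0 =
          Complex.I * deriv (D.curve i) t := by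
        simpa using ((Complex.ofRealCLM.hasDerivAt (x := (0 : ℝ))).mul_const
          (Complex.I * deriv (D.curve i) t)).deriv
      rw [h1]
      simpa using CrossChart.planeDet_mul_I_pos (D.deriv_curve_ne_zero i t))
  have hev := eventually_parameter_mem (D := D) (p := D.curve i t)
    (U := fun j => {s | j = i ∧ s ∈ {s : ℝ | ∃ k : ℤ, |s - t - k| < r}})
    (fun j => by
      by_cases hj : j = i
      · simpa [hj] using isOpen_translates t r
      · simp [hj])
    (fun j s k ⟨h1, m, h2⟩ => ⟨h1, m - k, by
      push_cast
      rwa [show s - t - (m - k : ℝ) = s + k - t - m by ring]⟩)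
    (fun j s hs => by
      obtain ⟨h1, k, h2⟩ := h.eq_of_curve_eq hs
      exact ⟨h1, k, by simpa [h2] using C.pos⟩)
  obtain ⟨s, hs, hsr, hsub⟩ := exists_small_box C hev
  refine ⟨s, C.restrict hs hsr, fun x hx hK => ?_⟩
  obtain ⟨j, τ, hτ⟩ := D.exists_curve_eq hK
  obtain ⟨rfl, k, hk⟩ := hsub x hx j τ hτ
  have h1 : C.toHomeo (τ - t - k, 0) = C.toHomeo x := by
    rw [C.apply_fst, show t + (τ - t - k) = τ + (-k : ℤ) by push_cast; ring, D.curve_add_int]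
    exact hτ
  have h2 := C.injOn (CrossChart.fst_mem_ball hk) (Metric.ball_subset_ball hsr hx) h1
  rw [← h2]

/-- The axes are the overpass and the underpass, and `σ` is the orientation of this pair. Absence of
triple points leaves no other branch nearby. -/
theorem Crossing.exists_chart (c : D.Crossing) :
    ∃ σ r, ∃ C : CrossChart (fun s => D.curve c.overpass.1 (c.overpass.2 + s))
      (fun s => D.curve c.underpass.1 (c.underpass.2 + s)) (D.proj c.overpass) σ r,
      ∀ x ∈ Metric.ball (0 : ℝ × ℝ) r, C.toHomeo x ∈ D.image → x.1 = 0 ∨ x.2 = 0 := by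
  have hdet := planeDet_ne_zero (D.transverse _ c.overpass_mem _ c.underpass_mem
    (overpass_ne_underpass c) c.proj_eq)
  obtain ⟨σ, hσ⟩ := CrossChart.exists_unit_mul_pos hdet
  obtain ⟨r, ⟨C⟩⟩ := CrossChart.exists_chart (σ := σ) (p := D.proj c.overpass)
    (contDiff_curve_shift (D := D) c.overpass.1 c.overpass.2)
    (contDiff_curve_shift (D := D) c.underpass.1 c.underpass.2)
    (by rw [add_zero]; rfl) (by rw [add_zero]; exact c.proj_eq.symm) (by
      rw [deriv_curve_shift, deriv_curve_shift, add_zero, add_zero]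
      exact hσ)
  have hev := eventually_parameter_mem (D := D) (p := D.proj c.overpass)
    (U := fun j => {s | ∃ b, j = (D.pass c b).1 ∧
      s ∈ {s : ℝ | ∃ k : ℤ, |s - (D.pass c b).2 - k| < r}})
    (fun j => by
      simp only [Set.ofPred_exists]
      refine isOpen_iUnion fun b => ?_
      by_cases hj : j = (D.pass c b).1
      · simpa [hj] using isOpen_translates (D.pass c b).2 r
      · simp [hj])
    (fun j s k ⟨b, h1, m, h2⟩ => ⟨b, h1, m - k, by
      push_cast
      rwa [show s - (D.pass c b).2 - (m - k : ℝ) = s + k - (D.pass c b).2 - m by ring]⟩)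
    (fun j s hs => by
      obtain ⟨b, h1, k, h2⟩ := exists_pass_of_curve_eq c hs
      exact ⟨b, h1, k, by simpa [h2] using C.pos⟩)
  obtain ⟨s, hs, hsr, hsub⟩ := exists_small_box C hev
  refine ⟨σ, s, C.restrict hs hsr, fun x hx hK => ?_⟩
  obtain ⟨j, τ, hτ⟩ := D.exists_curve_eq hK
  obtain ⟨b, rfl, k, hk⟩ := hsub x hx j τ hτ
  have hper : D.curve (D.pass c b).1 ((D.pass c b).2 + (τ - (D.pass c b).2 - k)) =
      C.toHomeo x := by
    rw [show (D.pass c b).2 + (τ - (D.pass c b).2 - k) = τ + (-k : ℤ) by push_cast; ring,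
      D.curve_add_int]
    exact hτ
  cases b
  · left
    rw [← C.injOn (CrossChart.snd_mem_ball hk) (Metric.ball_subset_ball hsr hx)
      ((C.apply_snd _).trans hper)]
  · right
    rw [← C.injOn (CrossChart.fst_mem_ball hk) (Metric.ball_subset_ball hsr hx)
      ((C.apply_fst _).trans hper)]

end LinkDiagram

/-! ### Regions next to the link and at the corners of crossings -/

namespace LinkDiagram

variable {l : ℕ} {D : LinkDiagram l}

theorem mem_regions_iff {R : Set ℂ} :
    R ∈ D.regions (id : ℂ → ℂ) ↔ ∃ z ∈ D.imageᶜ, R = connectedComponentIn D.imageᶜ z := by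
  simp [regions, components]

theorem region_subset (R : D.regions (id : ℂ → ℂ)) : (R : Set ℂ) ⊆ D.imageᶜ := by
  obtain ⟨z, -, h⟩ := mem_regions_iff.1 R.2
  rw [h]
  exact connectedComponentIn_subset _ _

theorem isOpen_region (R : D.regions (id : ℂ → ℂ)) : IsOpen (R : Set ℂ) := by
  obtain ⟨z, -, h⟩ := mem_regions_iff.1 R.2
  rw [h]
  exact D.isOpen_compl_image.connectedComponentIn

theorem isPreconnected_region (R : D.regions (id : ℂ → ℂ)) : IsPreconnected (R : Set ℂ) := by
  obtain ⟨z, -, h⟩ := mem_regions_iff.1 R.2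
  rw [h]
  exact isPreconnected_connectedComponentIn

theorem region_nonempty (R : D.regions (id : ℂ → ℂ)) : (R : Set ℂ).Nonempty := by
  obtain ⟨z, hz, h⟩ := mem_regions_iff.1 R.2
  exact ⟨z, h ▸ mem_connectedComponentIn hz⟩

theorem region_eq {R R' : D.regions (id : ℂ → ℂ)} {z : ℂ} (h : z ∈ (R : Set ℂ))
    (h' : z ∈ (R' : Set ℂ)) : R = R' := by
  obtain ⟨x, -, hR⟩ := mem_regions_iff.1 R.2
  obtain ⟨x', -, hR'⟩ := mem_regions_iff.1 R'.2
  apply Subtype.ext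
  rw [hR] at h ⊢
  rw [hR'] at h' ⊢
  rw [connectedComponentIn_eq h, connectedComponentIn_eq h']

theorem exists_region_superset {S : Set ℂ} (hS : IsPreconnected S) (hne : S.Nonempty)
    (h : S ⊆ D.imageᶜ) : ∃ R : D.regions (id : ℂ → ℂ), S ⊆ R := by
  obtain ⟨z, hz⟩ := hne
  exact ⟨⟨_, mem_regions_iff.2 ⟨z, h hz, rfl⟩⟩, hS.subset_connectedComponentIn hz h⟩

theorem exists_region_mem {z : ℂ} (hz : z ∉ D.image) :
    ∃ R : D.regions (id : ℂ → ℂ), z ∈ (R : Set ℂ) :=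
  (exists_region_superset isPreconnected_singleton (Set.singleton_nonempty z)
    (Set.singleton_subset_iff.2 hz)).imp fun _ h => h rfl

variable (D) in
/-- The regions on the left and on the right of the projected link at a parameter. -/
def Sides (i : Fin l) (t : ℝ) (L R : D.regions (id : ℂ → ℂ)) : Prop :=
  ∀ᶠ ε : ℝ in 𝓝[>] 0, D.curve i t + ε * (Complex.I * deriv (D.curve i) t) ∈ (L : Set ℂ) ∧
    D.curve i t - ε * (Complex.I * deriv (D.curve i) t) ∈ (R : Set ℂ)

theorem Sides.unique {i : Fin l} {t : ℝ} {L R L' R' : D.regions (id : ℂ → ℂ)}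
    (h : D.Sides i t L R) (h' : D.Sides i t L' R') : L = L' ∧ R = R' := by
  obtain ⟨ε, h1, h2⟩ := (h.and h').exists
  exact ⟨region_eq h1.1 h2.1, region_eq h1.2 h2.2⟩

theorem Sides.add_int {i : Fin l} {t : ℝ} {L R : D.regions (id : ℂ → ℂ)}
    (h : D.Sides i t L R) (k : ℤ) : D.Sides i (t + k) L R := by
  simpa only [Sides, D.curve_add_int, D.deriv_curve_add_int] using h

/-- The two open half boxes of the chart are connected and avoid the image, so each lies in one
region. The same two regions serve all nearby parameters. -/
theorem IsSimple.exists_sides {i : Fin l} {t : ℝ} (h : D.IsSimple i t) :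
    ∃ L R : D.regions (id : ℂ → ℂ), (∀ᶠ s in 𝓝 t, D.Sides i s L R) ∧
      ∀ᶠ z in 𝓝 (D.curve i t), z ∈ D.image ∨ z ∈ (L : Set ℂ) ∨ z ∈ (R : Set ℂ) := by
  obtain ⟨r, C, hC⟩ := h.exists_chart
  have hreg : ∀ δ : ℤˣ, ∃ R : D.regions (id : ℂ → ℂ),
      C.toHomeo '' CrossChart.halfBox r δ ⊆ R := by
    intro δ
    refine exists_region_superset
      (C.isPreconnected_image (CrossChart.convex_halfBox r δ) fun x hx => hx.1)
      (((CrossChart.quadrant_nonempty C.pos 1 δ).mono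
        (CrossChart.quadrant_subset_halfBox r 1 δ)).image _) ?_
    rintro _ ⟨x, hx, rfl⟩ hK
    have := hx.2
    rw [hC x hx.1 hK, mul_zero] at this
    exact lt_irrefl _ this
  choose R hR using hreg
  refine ⟨R 1, R (-1), ?_, ?_⟩
  · rw [Metric.eventually_nhds_iff]
    refine ⟨r, C.pos, fun s hs => ?_⟩
    rw [Real.dist_eq] at hs
    filter_upwards [C.eventually_sides_fst hs C.pos] with ε hε
    rw [deriv_curve_shift, add_sub_cancel] at hε
    obtain ⟨⟨y, hy, e, -, hy2⟩, z, hz, f, -, hz2⟩ := hε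
    exact ⟨e ▸ hR 1 ⟨y, ⟨hy, hy2⟩, rfl⟩, f ▸ hR (-1) ⟨z, ⟨hz, hz2⟩, rfl⟩⟩
  · filter_upwards [C.image_mem_nhds (Metric.ball_mem_nhds 0 C.pos)]
    rintro _ ⟨x, hx, rfl⟩
    by_cases h0 : x.2 = 0
    · left
      have : x = (x.1, 0) := Prod.ext rfl h0
      rw [this, C.apply_fst]
      exact D.curve_mem_image _ _
    · right
      obtain ⟨δ, hδ⟩ := CrossChart.exists_unit_mul_pos h0
      have := hR δ ⟨x, ⟨hx, hδ⟩, rfl⟩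
      rcases Int.units_eq_one_or δ with rfl | rfl
      · exact Or.inl this
      · exact Or.inr this

/-- The minus sign arises because the corner sign puts the underpass first, whereas `σ` puts the
overpass first. -/
theorem Crossing.cornerSign_eq (c : D.Crossing) {σ : ℤˣ}
    (h : 0 < ((σ : ℤ) : ℝ) * planeDet (D.tangent c.overpass) (D.tangent c.underpass))
    (ε δ : ℤˣ) : c.cornerSign ε δ = -(σ * ε * δ : ℤˣ) := by
  have h1 : (c.underRay δ).re * (c.overRay ε).im - (c.underRay δ).im * (c.overRay ε).re =
      -(((ε : ℤ) : ℝ) * ((δ : ℤ) : ℝ) *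
        planeDet (D.tangent c.overpass) (D.tangent c.underpass)) := by
    simp [overRay, underRay, planeDet]
    ring
  rw [cornerSign, h1]
  rcases Int.units_eq_one_or σ with rfl | rfl <;> rcases Int.units_eq_one_or ε with rfl | rfl <;>
    rcases Int.units_eq_one_or δ with rfl | rfl <;> simp at h ⊢ <;> first
      | (rw [sign_pos (by linarith)]; rfl)
      | (rw [sign_neg (by linarith)]; rfl)

/-- The regions at the four corners of a crossing, and their position with respect to the two
passes of the link through the crossing. -/
structure CornerRegions (c : D.Crossing) (σ : ℤˣ) (R : ℤˣ → ℤˣ → D.regions (id : ℂ → ℂ)) :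
    Prop where
  touches : ∀ ε δ, c.TouchesAt id (R ε δ : Set ℂ) ε δ
  sign : ∀ ε δ, c.cornerSign ε δ = -(σ * ε * δ : ℤˣ)
  over_sides : ∀ ε : ℤˣ, ∀ᶠ s in 𝓝 c.overpass.2, 0 < ((ε : ℤ) : ℝ) * (s - c.overpass.2) →
    D.Sides c.overpass.1 s (R ε σ) (R ε (-σ))
  under_sides : ∀ δ : ℤˣ, ∀ᶠ s in 𝓝 c.underpass.2, 0 < ((δ : ℤ) : ℝ) * (s - c.underpass.2) →
    D.Sides c.underpass.1 s (R (-σ) δ) (R σ δ)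
  cover : ∀ᶠ z in 𝓝 (D.proj c.overpass), z ∈ D.image ∨ ∃ ε δ, z ∈ (R ε δ : Set ℂ)

/-- Each open quadrant of the crossing chart is connected and avoids the image, so it lies in one
region; the four quadrants are the four corners. -/
theorem Crossing.exists_cornerRegions (c : D.Crossing) : ∃ σ R, CornerRegions c σ R := by
  obtain ⟨σ, r, C, hC⟩ := c.exists_chart
  have hreg : ∀ ε δ : ℤˣ, ∃ R : D.regions (id : ℂ → ℂ),
      C.toHomeo '' CrossChart.quadrant r ε δ ⊆ R := by
    intro ε δ
    refine exists_region_superset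
      (C.isPreconnected_image (CrossChart.convex_quadrant r ε δ) fun x hx => hx.1)
      ((CrossChart.quadrant_nonempty C.pos ε δ).image _) ?_
    rintro _ ⟨x, hx, rfl⟩ hK
    rcases hC x hx.1 hK with h | h
    · have := hx.2.1
      rw [h, mul_zero] at this
      exact lt_irrefl _ this
    · have := hx.2.2
      rw [h, mul_zero] at this
      exact lt_irrefl _ this
  choose R hR using hreg
  have hdet := C.det_pos 0 (Metric.mem_ball_self C.pos)
  rw [deriv_curve_shift, deriv_curve_shift, Prod.fst_zero, Prod.snd_zero, add_zero,
    add_zero] at hdet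
  -- A perturbation smaller than `|a|` keeps the sign, so a point near one half of an axis does not
  -- cross the other axis.
  have hnear : ∀ {ε : ℤˣ} {a x : ℝ}, 0 < ((ε : ℤ) : ℝ) * a → |x - a| < |a| →
      0 < ((ε : ℤ) : ℝ) * x := by
    intro ε a x h1 h2
    rcases Int.units_eq_one_or ε with rfl | rfl
    · simp only [Units.val_one, Int.cast_one, one_mul] at h1 ⊢
      rw [abs_of_pos h1] at h2
      linarith [(abs_lt.1 h2).1]
    · simp only [Units.val_neg, Units.val_one, Int.cast_neg, Int.cast_one, neg_mul, one_mul] at h1 ⊢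
      rw [abs_of_neg (show a < 0 by linarith)] at h2
      linarith [(abs_lt.1 h2).2]
  refine ⟨σ, R, ?_, fun ε δ => c.cornerSign_eq hdet ε δ, ?_, ?_, ?_⟩
  · intro ε δ
    filter_upwards [C.eventually_direction (Metric.mem_ball_self C.pos)
      (c.overRay ε + c.underRay δ) one_pos] with t ht
    obtain ⟨y, hy, e, -, -, h1, h2⟩ := ht
    rw [C.map_zero] at e
    refine e ▸ hR ε δ ⟨y, ⟨hy, ?_, ?_⟩, rfl⟩
    · have := h1 ε
      rw [Prod.fst_zero, sub_zero, Prod.snd_zero, deriv_curve_shift, add_zero] at this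
      apply this
      convert hdet using 1
      change _ = _ * planeDet (D.tangent c.overpass) (D.tangent c.underpass)
      change _ * (_ * planeDet _ (D.tangent c.underpass)) = _
      rcases Int.units_eq_one_or ε with rfl | rfl <;>
        simp [Crossing.overRay, Crossing.underRay, planeDet] <;> ring
    · have := h2 δ
      rw [Prod.fst_zero, Prod.snd_zero, sub_zero, deriv_curve_shift, add_zero] at this
      apply this
      convert hdet using 1
      change _ = _ * planeDet (D.tangent c.overpass) (D.tangent c.underpass)
      change _ * (_ * planeDet (D.tangent c.overpass) _) = _
      rcases Int.units_eq_one_or δ with rfl | rfl <;>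
        simp [Crossing.overRay, Crossing.underRay, planeDet] <;> ring
  · intro ε
    rw [Metric.eventually_nhds_iff]
    refine ⟨r, C.pos, fun s hs hpos => ?_⟩
    rw [Real.dist_eq] at hs
    have hne : s - c.overpass.2 ≠ 0 := by
      rintro h
      simp [h] at hpos
    filter_upwards [C.eventually_sides_fst hs (abs_pos.2 hne)] with t ht
    rw [deriv_curve_shift, add_sub_cancel] at ht
    obtain ⟨⟨y, hy, e, hy1, hy2⟩, z, hz, f, hz1, hz2⟩ := ht
    exact ⟨e ▸ hR ε σ ⟨y, ⟨hy, hnear hpos hy1, hy2⟩, rfl⟩,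
      f ▸ hR ε (-σ) ⟨z, ⟨hz, hnear hpos hz1, hz2⟩, rfl⟩⟩
  · intro δ
    rw [Metric.eventually_nhds_iff]
    refine ⟨r, C.pos, fun s hs hpos => ?_⟩
    rw [Real.dist_eq] at hs
    have hne : s - c.underpass.2 ≠ 0 := by
      rintro h
      simp [h] at hpos
    filter_upwards [C.eventually_sides_snd hs (abs_pos.2 hne)] with t ht
    rw [deriv_curve_shift, add_sub_cancel] at ht
    obtain ⟨⟨y, hy, e, hy1, hy2⟩, z, hz, f, hz1, hz2⟩ := ht
    exact ⟨e ▸ hR (-σ) δ ⟨y, ⟨hy, hy2, hnear hpos hy1⟩, rfl⟩,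
      f ▸ hR σ δ ⟨z, ⟨hz, hz2, hnear hpos hz1⟩, rfl⟩⟩
  · filter_upwards [C.image_mem_nhds (Metric.ball_mem_nhds 0 C.pos)]
    rintro _ ⟨x, hx, rfl⟩
    by_cases h0 : x.2 = 0
    · left
      have : x = (x.1, 0) := Prod.ext rfl h0
      rw [this, C.apply_fst]
      exact D.curve_mem_image _ _
    by_cases h1 : x.1 = 0
    · left
      have : x = (0, x.2) := Prod.ext h1 rfl
      rw [this, C.apply_snd]
      exact D.curve_mem_image _ _
    · right
      obtain ⟨δ, hδ⟩ := CrossChart.exists_unit_mul_pos h0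
      obtain ⟨ε, hε⟩ := CrossChart.exists_unit_mul_pos h1
      exact ⟨ε, δ, hR ε δ ⟨x, ⟨hx, hε, hδ⟩, rfl⟩⟩

end LinkDiagram

/-! ### Periodic piecewise constant functions -/

/-- A periodic piecewise constant function is determined by its breaks, whose sum vanishes. -/
theorem exists_piecewise_constant_eq {ι : Type*} [Fintype ι] {J : ℝ → ℂ}
    (hJ : Function.Periodic J 1) {τ : ι → ℝ} {δ : ι → ℂ} (hτ : ∀ q, τ q ∈ Set.Ico (0 : ℝ) 1)
    (h : ∀ t, ∃ x y, (∀ᶠ s in 𝓝[<] t, J s = x) ∧ (∀ᶠ s in 𝓝[>] t, J s = y) ∧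
      y - x = ∑ q, if τ q = Int.fract t then δ q else 0) :
    ∑ q, δ q = 0 ∧ ∃ x₀, ∀ t ∈ Set.Icc (0 : ℝ) 1, ∀ᶠ s in 𝓝[<] t,
      J s = x₀ + ∑ q, if τ q < t then δ q else 0 := by
  choose x y hx hy hxy using h
  have hxu : ∀ t z, (∀ᶠ s in 𝓝[<] t, J s = z) → x t = z := fun t z hz => by
    obtain ⟨s, h1, h2⟩ := ((hx t).and hz).exists
    exact h1.symm.trans h2
  have hsmall : ∀ t, ∀ᶠ s in 𝓝 t, ∀ q, τ q ≠ t → (τ q < s ↔ τ q < t) := by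
    intro t
    rw [Filter.eventually_all]
    intro q
    rcases lt_trichotomy (τ q) t with hq | hq | hq
    · filter_upwards [lt_mem_nhds hq] with s hs _
      exact iff_of_true hs hq
    · exact Filter.Eventually.of_forall fun s hs => (hs hq).elim
    · filter_upwards [gt_mem_nhds hq] with s hs _
      exact iff_of_false hs.not_gt hq.not_gt
  -- Subtracting the breaks passed so far from the left limit `x` leaves a locally constant function
  -- on `[0, 1]`. The inequality `τ q < t` is strict because a left limit does not yet see a break
  -- at `t`.
  have key : ∀ t ∈ Set.Icc (0 : ℝ) 1, ∀ᶠ s in 𝓝[Set.Icc 0 1] t,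
      x s - ∑ q, (if τ q < s then δ q else 0) = x t - ∑ q, if τ q < t then δ q else 0 := by
    intro t ht
    have hl : ∀ᶠ s in 𝓝 t, s < t → x s = x t := by
      have h1 := eventually_eventually_nhdsWithin.2 (hx t)
      rw [eventually_nhdsWithin_iff] at h1
      filter_upwards [h1] with s hs hst
      apply hxu
      exact (hs hst).filter_mono (nhdsWithin_le_of_mem
        (mem_nhdsWithin_of_mem_nhds (Iio_mem_nhds hst)))
    have hr : ∀ᶠ s in 𝓝 t, t < s → x s = y t := by
      have h1 := eventually_eventually_nhdsWithin.2 (hy t)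
      rw [eventually_nhdsWithin_iff] at h1
      filter_upwards [h1] with s hs hst
      apply hxu
      exact (hs hst).filter_mono (nhdsWithin_le_of_mem
        (mem_nhdsWithin_of_mem_nhds (Ioi_mem_nhds hst)))
    rw [eventually_nhdsWithin_iff]
    filter_upwards [hl, hr, hsmall t] with s h1 h2 h3 hs
    rcases lt_trichotomy s t with hst | rfl | hst
    · rw [h1 hst]
      congr 1
      refine Finset.sum_congr rfl fun q _ => ?_
      by_cases hq : τ q = t
      · rw [if_neg (by rw [hq]; exact hst.not_gt), if_neg (by rw [hq]; exact lt_irrefl t)]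
      · simp only [h3 q hq]
    · rfl
    · rw [h2 hst]
      have hfr : Int.fract t = t := Int.fract_eq_self.2 ⟨ht.1, hst.trans_le hs.2⟩
      have h4 : ∑ q, (if τ q < s then δ q else 0) =
          ∑ q, (if τ q < t then δ q else 0) + ∑ q, (if τ q = Int.fract t then δ q else 0) := by
        rw [← Finset.sum_add_distrib]
        refine Finset.sum_congr rfl fun q _ => ?_
        rw [hfr]
        by_cases hq : τ q = t
        · simp [hq, hst]
        · simp [h3 q hq, hq]
      rw [h4, ← hxy]
      ring
  have hconst : ∀ t ∈ Set.Icc (0 : ℝ) 1,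
      x t - ∑ q, (if τ q < t then δ q else 0) = x 0 := by
    intro t ht
    have h1 := isPreconnected_Icc.eq_of_eventually_eq
      (f := fun t => x t - ∑ q, (if τ q < t then δ q else 0)) key ht
      (⟨le_rfl, zero_le_one⟩ : (0 : ℝ) ∈ Set.Icc (0 : ℝ) 1)
    rw [h1, sub_eq_self]
    exact Finset.sum_eq_zero fun q _ => if_neg (hτ q).1.not_gt
  refine ⟨?_, x 0, fun t ht => ?_⟩
  · have h1 := hconst 1 ⟨zero_le_one, le_rfl⟩
    -- By periodicity the left limits at `0` and `1` agree, so the sum of all breaks vanishes.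
    have h2 : x 1 = x 0 := by
      apply hxu
      have h3 : Filter.Tendsto (fun s : ℝ => s - 1) (𝓝[<] 1) (𝓝[<] 0) := by
        have h4 : Filter.Tendsto (fun s : ℝ => s - 1) (𝓝 1) (𝓝 0) := by
          have : Continuous fun s : ℝ => s - 1 := by fun_prop
          simpa using this.tendsto 1
        refine tendsto_nhdsWithin_iff.2 ⟨h4.mono_left nhdsWithin_le_nhds, ?_⟩
        filter_upwards [self_mem_nhdsWithin] with s hs
        exact sub_neg.2 (Set.mem_Iio.1 hs)
      filter_upwards [h3.eventually (hx 0)] with s hs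
      rwa [hJ.sub_eq] at hs
    rw [h2, sub_eq_self] at h1
    rw [← h1]
    exact Finset.sum_congr rfl fun q _ => (if_pos (hτ q).2).symm
  · filter_upwards [hx t] with s hs
    rw [hs, ← hconst t ht]
    ring

/-! ### Jumps across the link and alternating corner sums -/

namespace LinkDiagram

variable {l : ℕ} {D : LinkDiagram l}

open Classical in
/-- The jump of a function on the regions across the projected link. -/
noncomputable def jump (i : Fin l) (t : ℝ) : (D.regions (id : ℂ → ℂ) → ℂ) →ₗ[ℂ] ℂ :=
  if h : ∃ L R : D.regions (id : ℂ → ℂ), D.Sides i t L R then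
    LinearMap.proj (R := ℂ) (φ := fun _ => ℂ) h.choose -
      LinearMap.proj (R := ℂ) (φ := fun _ => ℂ) h.choose_spec.choose else 0

theorem Sides.jump_eq {i : Fin l} {t : ℝ} {L R : D.regions (id : ℂ → ℂ)} (h : D.Sides i t L R)
    (u : D.regions (id : ℂ → ℂ) → ℂ) : jump i t u = u L - u R := by
  have hex : ∃ L R : D.regions (id : ℂ → ℂ), D.Sides i t L R := ⟨L, R, h⟩
  obtain ⟨h1, h2⟩ := h.unique hex.choose_spec.choose_spec
  rw [jump, dif_pos hex]
  change u hex.choose - u hex.choose_spec.choose = _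
  rw [← h2, ← h1]

theorem jump_add_int (i : Fin l) (t : ℝ) (k : ℤ) (u : D.regions (id : ℂ → ℂ) → ℂ) :
    jump i (t + k) u = jump i t u := by
  by_cases hex : ∃ L R : D.regions (id : ℂ → ℂ), D.Sides i t L R
  · obtain ⟨L, R, h⟩ := hex
    rw [h.jump_eq, (h.add_int k).jump_eq]
  · have hex' : ¬∃ L R : D.regions (id : ℂ → ℂ), D.Sides i (t + k) L R := by
      rintro ⟨L, R, h⟩
      refine hex ⟨L, R, ?_⟩
      simpa using h.add_int (-k)
    rw [jump, dif_neg hex', jump, dif_neg hex]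

/-- The sign for which the given corners of a crossing are positive. -/
noncomputable def Crossing.orientation (c : D.Crossing) : ℤˣ := c.exists_cornerRegions.choose

/-- The region at a corner of a crossing. -/
noncomputable def Crossing.cornerRegion (c : D.Crossing) :
    ℤˣ → ℤˣ → D.regions (id : ℂ → ℂ) :=
  c.exists_cornerRegions.choose_spec.choose

theorem Crossing.cornerRegions (c : D.Crossing) :
    CornerRegions c c.orientation c.cornerRegion :=
  c.exists_cornerRegions.choose_spec.choose_spec

variable (D) in
/-- The alternating sum of a function on the regions over the corners of each crossing. -/
noncomputable def cornerSum : (D.regions (id : ℂ → ℂ) → ℂ) →ₗ[ℂ] (D.Crossing → ℂ) :=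
  LinearMap.pi fun c => ∑ ε : ℤˣ, ∑ δ : ℤˣ,
    ((c.cornerSign ε δ : ℤ) : ℂ) • LinearMap.proj (c.cornerRegion ε δ)

theorem cornerSum_apply (u : D.regions (id : ℂ → ℂ) → ℂ) (c : D.Crossing) :
    D.cornerSum u c = -((c.orientation : ℤ) : ℂ) *
      (u (c.cornerRegion 1 1) - u (c.cornerRegion 1 (-1)) - u (c.cornerRegion (-1) 1) +
        u (c.cornerRegion (-1) (-1))) := by
  simp [cornerSum, c.cornerRegions.sign]
  ring

/-- The break of a jump function at a pass through a crossing with the given corner sum. -/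
def passBreak (b : Bool) (w : ℂ) : ℂ := bif b then -w else w

/-- The jumps before and after a pass are differences of `u` at adjacent corners. Their difference
is, up to sign, the alternating sum over all four corners, with opposite signs for the two passes.
-/
theorem exists_jump_limits_pass (u : D.regions (id : ℂ → ℂ) → ℂ) (c : D.Crossing) (b : Bool) :
    ∃ x y, (∀ᶠ s in 𝓝[<] (D.pass c b).2, jump (D.pass c b).1 s u = x) ∧
      (∀ᶠ s in 𝓝[>] (D.pass c b).2, jump (D.pass c b).1 s u = y) ∧
      y - x = passBreak b (D.cornerSum u c) := by
  have hc := c.cornerRegions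
  cases b
  · refine ⟨u (c.cornerRegion (-c.orientation) (-1)) - u (c.cornerRegion c.orientation (-1)),
      u (c.cornerRegion (-c.orientation) 1) - u (c.cornerRegion c.orientation 1), ?_, ?_, ?_⟩
    · rw [eventually_nhdsWithin_iff]
      filter_upwards [hc.under_sides (-1)] with s hs hlt
      exact (hs (by simpa [pass] using hlt)).jump_eq u
    · rw [eventually_nhdsWithin_iff]
      filter_upwards [hc.under_sides 1] with s hs hlt
      exact (hs (by simpa [pass] using hlt)).jump_eq u
    · rw [cornerSum_apply]
      rcases Int.units_eq_one_or c.orientation with h | h <;> simp [h, passBreak] <;> ring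
  · refine ⟨u (c.cornerRegion (-1) c.orientation) - u (c.cornerRegion (-1) (-c.orientation)),
      u (c.cornerRegion 1 c.orientation) - u (c.cornerRegion 1 (-c.orientation)), ?_, ?_, ?_⟩
    · rw [eventually_nhdsWithin_iff]
      filter_upwards [hc.over_sides (-1)] with s hs hlt
      exact (hs (by simpa [pass] using hlt)).jump_eq u
    · rw [eventually_nhdsWithin_iff]
      filter_upwards [hc.over_sides 1] with s hs hlt
      exact (hs (by simpa [pass] using hlt)).jump_eq u
    · rw [cornerSum_apply]
      rcases Int.units_eq_one_or c.orientation with h | h <;> simp [h, passBreak] <;> ring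

theorem IsSimple.eventually_jump_eq {i : Fin l} {t : ℝ} (h : D.IsSimple i t)
    (u : D.regions (id : ℂ → ℂ) → ℂ) : ∀ᶠ s in 𝓝 t, jump i s u = jump i t u := by
  obtain ⟨L, R, hs, -⟩ := h.exists_sides
  filter_upwards [hs] with s hLR
  rw [hLR.jump_eq, hs.self_of_nhds.jump_eq]

theorem tendsto_sub_intCast_nhdsWithin (t : ℝ) (k : ℤ) :
    Filter.Tendsto (fun s : ℝ => s - k) (𝓝[<] t) (𝓝[<] (t - k)) ∧
      Filter.Tendsto (fun s : ℝ => s - k) (𝓝[>] t) (𝓝[>] (t - k)) := by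
  have h4 : Filter.Tendsto (fun s : ℝ => s - k) (𝓝 t) (𝓝 (t - k)) := by
    have : Continuous fun s : ℝ => s - k := by fun_prop
    exact this.tendsto t
  constructor
  · refine tendsto_nhdsWithin_iff.2 ⟨h4.mono_left nhdsWithin_le_nhds, ?_⟩
    filter_upwards [self_mem_nhdsWithin] with s hs
    exact sub_lt_sub_right (Set.mem_Iio.1 hs) _
  · refine tendsto_nhdsWithin_iff.2 ⟨h4.mono_left nhdsWithin_le_nhds, ?_⟩
    filter_upwards [self_mem_nhdsWithin] with s hs
    exact sub_lt_sub_right (Set.mem_Ioi.1 hs) _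

open Classical in
theorem exists_jump_limits [Fintype D.Crossing] (u : D.regions (id : ℂ → ℂ) → ℂ) (i : Fin l)
    (t : ℝ) :
    ∃ x y, (∀ᶠ s in 𝓝[<] t, jump i s u = x) ∧ (∀ᶠ s in 𝓝[>] t, jump i s u = y) ∧
      y - x = ∑ q : D.Crossing × Bool,
        if D.pass q.1 q.2 = (i, Int.fract t) then passBreak q.2 (D.cornerSum u q.1) else 0 := by
  by_cases hs : D.IsSimple i t
  · have h := hs.eventually_jump_eq u
    refine ⟨_, _, h.filter_mono nhdsWithin_le_nhds, h.filter_mono nhdsWithin_le_nhds, ?_⟩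
    rw [sub_self]
    exact (Finset.sum_eq_zero fun q _ => if_neg (hs q.1 q.2)).symm
  · simp only [IsSimple, not_forall, not_not] at hs
    obtain ⟨c, b, hcb⟩ := hs
    obtain ⟨x, y, hx, hy, hxy⟩ := exists_jump_limits_pass u c b
    rw [hcb] at hx hy
    -- The pass parameters lie in `[0, 1)`, so the limits at `t` are transported from its fractional
    -- part. Only one term of the sum survives, by `pass_injective`.
    have hfr : t - ⌊t⌋ = Int.fract t := rfl
    obtain ⟨h1, h2⟩ := tendsto_sub_intCast_nhdsWithin t ⌊t⌋
    have hj : ∀ s : ℝ, jump i (s - ⌊t⌋) u = jump i s u := fun s => by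
      rw [← jump_add_int i (s - ⌊t⌋) ⌊t⌋, sub_add_cancel]
    refine ⟨x, y, ?_, ?_, ?_⟩
    · filter_upwards [h1.eventually hx] with s hs
      rwa [← hj]
    · filter_upwards [h2.eventually hy] with s hs
      rwa [← hj]
    · rw [hxy, Finset.sum_eq_single (c, b), if_pos hcb]
      · intro q _ hq
        refine if_neg fun h => hq ?_
        obtain ⟨h1, h2⟩ := pass_injective (h.trans hcb.symm)
        exact Prod.ext h1 h2
      · simp

open Classical in
-- The first part is the linear constraint on corner sums, one for each link component. The second
-- shows that the corner sums and one initial value determine the jumps along a component.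
theorem exists_jump_eq [Fintype D.Crossing] (u : D.regions (id : ℂ → ℂ) → ℂ) (i : Fin l) :
    (∑ q : D.Crossing × Bool,
        if (D.pass q.1 q.2).1 = i then passBreak q.2 (D.cornerSum u q.1) else 0) = 0 ∧
      ∃ x₀, ∀ t ∈ Set.Icc (0 : ℝ) 1, ∀ᶠ s in 𝓝[<] t, jump i s u = x₀ + ∑ q : D.Crossing × Bool,
        if (D.pass q.1 q.2).2 < t then
          (if (D.pass q.1 q.2).1 = i then passBreak q.2 (D.cornerSum u q.1) else 0) else 0 := by
  refine exists_piecewise_constant_eq (J := fun s => jump i s u)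
    (τ := fun q : D.Crossing × Bool => (D.pass q.1 q.2).2)
    (δ := fun q => if (D.pass q.1 q.2).1 = i then passBreak q.2 (D.cornerSum u q.1) else 0)
    (fun t => by simpa using jump_add_int i t 1 u) (fun q => pass_mem q.1 q.2) fun t => ?_
  obtain ⟨x, y, hx, hy, hxy⟩ := exists_jump_limits u i t
  refine ⟨x, y, hx, hy, hxy.trans (Finset.sum_congr rfl fun q _ => ?_)⟩
  rw [← ite_and]
  congr 1
  rw [Prod.ext_iff]
  simp [and_comm]

theorem mem_image_cases {p : ℂ} (hp : p ∈ D.image) :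
    (∃ i, ∃ t ∈ Set.Ico (0 : ℝ) 1, D.IsSimple i t ∧ D.curve i t = p) ∨
      ∃ c : D.Crossing, D.proj c.overpass = p := by
  obtain ⟨⟨i, t⟩, ht, rfl⟩ := hp
  by_cases hs : D.IsSimple i t
  · exact Or.inl ⟨i, t, ht, hs, rfl⟩
  · right
    simp only [IsSimple, not_forall, not_not] at hs
    obtain ⟨c, b, hcb⟩ := hs
    rw [Int.fract_eq_self.2 ht] at hcb
    exact ⟨c, by rw [← proj_pass c b, hcb]⟩

theorem tendsto_add_mul_nhds (p v : ℂ) :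
    Filter.Tendsto (fun ε : ℝ => p + ε * v) (𝓝[>] 0) (𝓝 p) := by
  have : Continuous fun ε : ℝ => p + ε * v := by fun_prop
  simpa using (this.tendsto 0).mono_left nhdsWithin_le_nhds

theorem frequently_notMem_image (p : ℂ) : ∃ᶠ z in 𝓝 p, z ∉ D.image := by
  by_cases hp : p ∈ D.image
  · rcases mem_image_cases hp with ⟨i, t, -, hs, rfl⟩ | ⟨c, rfl⟩
    · obtain ⟨L, R, h, -⟩ := hs.exists_sides
      refine (tendsto_add_mul_nhds _ (Complex.I * deriv (D.curve i) t)).frequently ?_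
      exact (h.self_of_nhds.mono fun ε hε => region_subset L hε.1).frequently
    · refine (tendsto_add_mul_nhds _ (c.overRay 1 + c.underRay 1)).frequently ?_
      exact Filter.Eventually.frequently
        ((c.cornerRegions.touches 1 1).mono fun ε hε => region_subset _ hε)
  · exact Filter.Eventually.frequently (D.isOpen_compl_image.mem_nhds hp)

/-- The local values `v` extend `u` over the image. Since the complement of the image is dense,
values at nearby points are compared at a common point off the image, so `v` is locally constant on
the connected plane. -/
theorem eq_of_forall_locally_eq {u : D.regions (id : ℂ → ℂ) → ℂ}
    (h : ∀ p ∈ D.image, ∃ v, ∀ᶠ z in 𝓝 p, ∀ R : D.regions (id : ℂ → ℂ), z ∈ (R : Set ℂ) → u R = v)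
    (R R' : D.regions (id : ℂ → ℂ)) : u R = u R' := by
  have h' : ∀ p, ∃ v, ∀ᶠ z in 𝓝 p, ∀ R : D.regions (id : ℂ → ℂ), z ∈ (R : Set ℂ) → u R = v := by
    intro p
    by_cases hp : p ∈ D.image
    · exact h p hp
    · obtain ⟨R, hR⟩ := exists_region_mem hp
      refine ⟨u R, ?_⟩
      filter_upwards [(isOpen_region R).mem_nhds hR] with z hz R' hR'
      rw [region_eq hz hR']
  choose v hv using h'
  have hloc : ∀ p ∈ Set.univ, ∀ᶠ p' in 𝓝[Set.univ] p, v p' = v p := by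
    intro p _
    rw [nhdsWithin_univ]
    filter_upwards [eventually_eventually_nhds.2 (hv p)] with p' hp'
    obtain ⟨z, hz, h1, h2⟩ :=
      ((frequently_notMem_image (D := D) p').and_eventually (hp'.and (hv p'))).exists
    obtain ⟨R, hR⟩ := exists_region_mem hz
    rw [← h1 R hR, ← h2 R hR]
  obtain ⟨z, hz⟩ := region_nonempty R
  obtain ⟨z', hz'⟩ := region_nonempty R'
  rw [(hv z).self_of_nhds R hz, (hv z').self_of_nhds R' hz']
  exact isPreconnected_univ.eq_of_eventually_eq hloc trivial trivial

/-- A function on the regions without jumps is constant. -/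
theorem eq_of_cornerSum_eq_zero [Fintype D.Crossing] {u : D.regions (id : ℂ → ℂ) → ℂ}
    (hu : D.cornerSum u = 0) {base : Fin l → ℝ} (hbase : ∀ i, base i ∈ Set.Icc (0 : ℝ) 1)
    (hsimple : ∀ i, D.IsSimple i (base i)) (hjump : ∀ i, jump i (base i) u = 0)
    (R R' : D.regions (id : ℂ → ℂ)) : u R = u R' := by
  classical
  have hleft : ∀ i, ∀ t ∈ Set.Icc (0 : ℝ) 1, ∀ᶠ s in 𝓝[<] t, jump i s u = 0 := by
    intro i
    obtain ⟨-, x₀, h⟩ := exists_jump_eq u i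
    have h' : ∀ t ∈ Set.Icc (0 : ℝ) 1, ∀ᶠ s in 𝓝[<] t, jump i s u = x₀ := by
      intro t ht
      filter_upwards [h t ht] with s hs
      rw [hs, hu]
      simp [passBreak]
    have h0 : x₀ = 0 := by
      have h1 := ((hsimple i).eventually_jump_eq u).filter_mono
        (nhdsWithin_le_nhds (s := Set.Iio (base i)))
      obtain ⟨s, h2, h3⟩ := (h1.and (h' _ (hbase i))).exists
      rw [← h3, h2, hjump]
    rwa [h0] at h'
  refine eq_of_forall_locally_eq (fun p hp => ?_) R R'
  rcases mem_image_cases hp with ⟨i, t, ht, hs, rfl⟩ | ⟨c, rfl⟩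
  · obtain ⟨L, R, h, hcov⟩ := hs.exists_sides
    have hLR : u L = u R := by
      obtain ⟨s, h1, h2⟩ := ((h.filter_mono nhdsWithin_le_nhds).and
        (hleft i t (Set.Ico_subset_Icc_self ht))).exists
      rw [h1.jump_eq] at h2
      exact sub_eq_zero.1 h2
    refine ⟨u R, ?_⟩
    filter_upwards [hcov] with z hz R' hR'
    rcases hz with hz | hz | hz
    · exact (region_subset R' hR' hz).elim
    · rw [region_eq hR' hz, hLR]
    · rw [region_eq hR' hz]
  · have hc := c.cornerRegions
    -- The left limit is zero and there is no break, so the right limit is zero too. Crossing the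
    -- half-branches then identifies the values at all four corners.
    have hlim : ∀ b, (∀ᶠ s in 𝓝[<] (D.pass c b).2, jump (D.pass c b).1 s u = 0) ∧
        (∀ᶠ s in 𝓝[>] (D.pass c b).2, jump (D.pass c b).1 s u = 0) := by
      intro b
      have h1 := hleft (D.pass c b).1 (D.pass c b).2 (Set.Ico_subset_Icc_self (pass_mem c b))
      obtain ⟨x, y, hx, hy, hxy⟩ := exists_jump_limits_pass u c b
      obtain ⟨s, h2, h3⟩ := (h1.and hx).exists
      have hx0 : x = 0 := h3.symm.trans h2
      have hy0 : y = 0 := by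
        rw [hu, hx0] at hxy
        cases b <;> simpa [passBreak] using hxy
      rw [hy0] at hy
      exact ⟨h1, hy⟩
    have hover : ∀ ε, u (c.cornerRegion ε c.orientation) =
        u (c.cornerRegion ε (-c.orientation)) := by
      intro ε
      have h1 := hc.over_sides ε
      rcases Int.units_eq_one_or ε with rfl | rfl
      · obtain ⟨s, h2, h3, h4⟩ := ((hlim true).2.and
          ((h1.filter_mono nhdsWithin_le_nhds).and self_mem_nhdsWithin)).exists
        have h5 : c.overpass.2 < s := h4
        change jump c.overpass.1 s u = 0 at h2
        rw [(h3 (by simpa using h5)).jump_eq] at h2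
        exact sub_eq_zero.1 h2
      · obtain ⟨s, h2, h3, h4⟩ := ((hlim true).1.and
          ((h1.filter_mono nhdsWithin_le_nhds).and self_mem_nhdsWithin)).exists
        have h5 : s < c.overpass.2 := h4
        change jump c.overpass.1 s u = 0 at h2
        rw [(h3 (by simpa using h5)).jump_eq] at h2
        exact sub_eq_zero.1 h2
    have hunder : ∀ δ, u (c.cornerRegion (-c.orientation) δ) =
        u (c.cornerRegion c.orientation δ) := by
      intro δ
      have h1 := hc.under_sides δ
      rcases Int.units_eq_one_or δ with rfl | rfl
      · obtain ⟨s, h2, h3, h4⟩ := ((hlim false).2.and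
          ((h1.filter_mono nhdsWithin_le_nhds).and self_mem_nhdsWithin)).exists
        have h5 : c.underpass.2 < s := h4
        change jump c.underpass.1 s u = 0 at h2
        rw [(h3 (by simpa using h5)).jump_eq] at h2
        exact sub_eq_zero.1 h2
      · obtain ⟨s, h2, h3, h4⟩ := ((hlim false).1.and
          ((h1.filter_mono nhdsWithin_le_nhds).and self_mem_nhdsWithin)).exists
        have h5 : s < c.underpass.2 := h4
        change jump c.underpass.1 s u = 0 at h2
        rw [(h3 (by simpa using h5)).jump_eq] at h2
        exact sub_eq_zero.1 h2
    refine ⟨u (c.cornerRegion 1 1), ?_⟩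
    filter_upwards [hc.cover] with z hz R' hR'
    rcases hz with hz | ⟨ε, δ, hz⟩
    · exact (region_subset R' hR' hz).elim
    · rw [region_eq hR' hz]
      have h1 := hover 1
      have h2 := hover (-1)
      have h3 := hunder 1
      have h4 := hunder (-1)
      rcases Int.units_eq_one_or c.orientation with h | h <;> rw [h] at h1 h2 h3 h4 <;>
        rcases Int.units_eq_one_or ε with rfl | rfl <;>
        rcases Int.units_eq_one_or δ with rfl | rfl <;> simp_all

end LinkDiagram

/-! ### Functions on the regions from Cauchy integrals over the link -/

namespace LinkDiagram

variable {l : ℕ} {D : LinkDiagram l}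

/-- The arc from `a` to `1` meets the simple point at most at the parameter `t` itself. Thus an arc
starting at `a` contributes a unit step at `a` to the density, and piecewise constant densities are
sums of such arcs. -/
theorem tendsto_cauchyIntegral_curve {j : Fin l} {t : ℝ} (ht : t ∈ Set.Ioo (0 : ℝ) 1)
    (hs : D.IsSimple j t) (i : Fin l) {a : ℝ} (ha : a ∈ Set.Ico (0 : ℝ) 1)
    (hat : i = j → a ≠ t) :
    Filter.Tendsto (fun ε : ℝ =>
      cauchyIntegral (D.curve i) a 1 (D.curve j t + ε * (Complex.I * deriv (D.curve j) t)) -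
        cauchyIntegral (D.curve i) a 1 (D.curve j t - ε * (Complex.I * deriv (D.curve j) t)))
      (𝓝[>] 0) (𝓝 (2 * Real.pi * Complex.I * if i = j ∧ a < t then 1 else 0)) := by
  have huniq : ∀ s ∈ Set.Icc a 1, D.curve i s = D.curve j t → i = j ∧ s = t := by
    intro s hsa he
    obtain ⟨h1, k, h2⟩ := hs.eq_of_curve_eq he
    refine ⟨h1, ?_⟩
    have h3 : (k : ℝ) < 1 := by linarith [hsa.2, ht.1]
    have h4 : (-1 : ℝ) < k := by linarith [hsa.1, ha.1, ht.2]
    have h5 : k < 1 := by exact_mod_cast h3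
    have h6 : -1 < k := by exact_mod_cast h4
    have h7 : k = 0 := by omega
    simpa [h7] using h2
  split_ifs with h
  · obtain ⟨rfl, hlt⟩ := h
    rw [mul_one]
    refine tendsto_cauchyIntegral_jump (D.contDiff_curve i) hlt ht.2 (D.deriv_curve_ne_zero i t)
      (fun s hsa hne he => hne (huniq s hsa he).2) ?_
    obtain ⟨L, R, hLR, -⟩ := hs.exists_sides
    filter_upwards [hLR.self_of_nhds] with ε hε s _
    exact ⟨fun he => region_subset L hε.1 (he ▸ D.curve_mem_image i s),
      fun he => region_subset R hε.2 (he ▸ D.curve_mem_image i s)⟩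
  · rw [mul_zero]
    refine tendsto_sub_of_continuousAt (hasDerivAt_cauchyIntegral (D.contDiff_curve i) ha.2.le
      fun s hsa he => h ?_).continuousAt _
    obtain ⟨h1, rfl⟩ := huniq s hsa he
    exact ⟨h1, lt_of_le_of_ne hsa.1 (hat h1)⟩

/-- The Cauchy integral over the whole link, with a density that is constant on each component
except for breaks at the passes through the crossings. -/
noncomputable def linkIntegral [Fintype D.Crossing] (b : Fin l → ℂ) (w : D.Crossing → ℂ) (z : ℂ) :
    ℂ :=
  ∑ i, b i * cauchyIntegral (D.curve i) 0 1 z +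
    ∑ q : D.Crossing × Bool, passBreak q.2 (w q.1) *
      cauchyIntegral (D.curve (D.pass q.1 q.2).1) (D.pass q.1 q.2).2 1 z

theorem curve_pass (c : D.Crossing) (b : Bool) :
    D.curve (D.pass c b).1 (D.pass c b).2 = D.proj c.overpass := proj_pass c b

/-- All endpoint terms cancel. Full components are closed; the two arcs starting at a crossing begin
at the same point of the plane with opposite weights; and the weights of the arcs ending at
parameter `1` of a component add up to zero by `hw`. -/
theorem hasDerivAt_linkIntegral [Fintype D.Crossing] (b : Fin l → ℂ) {w : D.Crossing → ℂ}
    (hw : ∀ i, (∑ q : D.Crossing × Bool,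
      if (D.pass q.1 q.2).1 = i then passBreak q.2 (w q.1) else 0) = 0) {z : ℂ}
    (hz : z ∉ D.image) : HasDerivAt (linkIntegral b w) 0 z := by
  have hne : ∀ i t, D.curve i t ≠ z := fun i t h => hz (h ▸ D.curve_mem_image i t)
  have h1 := HasDerivAt.fun_sum fun (i : Fin l) (_ : i ∈ Finset.univ) =>
    (hasDerivAt_cauchyIntegral (D.contDiff_curve i) zero_le_one (z := z)
      fun t _ => hne i t).const_mul (b i)
  have h2 := HasDerivAt.fun_sum fun (q : D.Crossing × Bool) (_ : q ∈ Finset.univ) =>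
    (hasDerivAt_cauchyIntegral (D.contDiff_curve (D.pass q.1 q.2).1) (pass_mem q.1 q.2).2.le (z := z)
      fun t _ => hne _ t).const_mul (passBreak q.2 (w q.1))
  refine (h1.add h2).congr_deriv ?_
  have e1 : ∀ i, D.curve i 1 = D.curve i 0 := fun i => by
    simpa using D.curve_add_int i 0 1
  have e2 : ∑ q : D.Crossing × Bool,
      passBreak q.2 (w q.1) * (D.proj q.1.overpass - z)⁻¹ = 0 := by
    rw [Fintype.sum_prod_type]
    refine Finset.sum_eq_zero fun c _ => ?_
    simp [passBreak]
  have e3 : ∑ q : D.Crossing × Bool,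
      passBreak q.2 (w q.1) * (D.curve (D.pass q.1 q.2).1 1 - z)⁻¹ = 0 := by
    have h3 : ∀ q : D.Crossing × Bool,
        passBreak q.2 (w q.1) * (D.curve (D.pass q.1 q.2).1 1 - z)⁻¹ =
        ∑ i, (if (D.pass q.1 q.2).1 = i then passBreak q.2 (w q.1) else 0) *
          (D.curve i 1 - z)⁻¹ := fun q => by simp
    rw [Finset.sum_congr rfl fun q _ => h3 q, Finset.sum_comm]
    refine Finset.sum_eq_zero fun i _ => ?_
    rw [← Finset.sum_mul, hw, zero_mul]
  simp only [curve_pass, mul_sub, Finset.sum_sub_distrib, e1, sub_self, e2]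
  simp only [e1] at e3
  rw [e3]
  simp

/-- The function on the regions whose jumps across the link are given by a density that is constant
on each component except for breaks at the passes through the crossings. -/
noncomputable def densityFunction [Fintype D.Crossing] (b : Fin l → ℂ) (w : D.Crossing → ℂ)
    (R : D.regions (id : ℂ → ℂ)) : ℂ :=
  linkIntegral b w (region_nonempty R).some / (2 * Real.pi * Complex.I)

theorem linkIntegral_eq [Fintype D.Crossing] (b : Fin l → ℂ) {w : D.Crossing → ℂ}
    (hw : ∀ i, (∑ q : D.Crossing × Bool,
      if (D.pass q.1 q.2).1 = i then passBreak q.2 (w q.1) else 0) = 0)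
    {R : D.regions (id : ℂ → ℂ)} {z : ℂ} (hz : z ∈ (R : Set ℂ)) :
    linkIntegral b w z = 2 * Real.pi * Complex.I * densityFunction b w R := by
  rw [densityFunction, mul_div_cancel₀ _ Complex.two_pi_I_ne_zero]
  have h : ∀ x ∈ (R : Set ℂ), HasDerivAt (linkIntegral b w) 0 x := fun x hx =>
    hasDerivAt_linkIntegral b hw (region_subset R hx)
  exact (isOpen_region R).is_const_of_deriv_eq_zero (isPreconnected_region R)
    (fun x hx => (h x hx).differentiableAt.differentiableWithinAt) (fun x hx => (h x hx).deriv)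
    hz (region_nonempty R).some_mem

theorem jump_densityFunction [Fintype D.Crossing] (b : Fin l → ℂ) {w : D.Crossing → ℂ}
    (hw : ∀ i, (∑ q : D.Crossing × Bool,
      if (D.pass q.1 q.2).1 = i then passBreak q.2 (w q.1) else 0) = 0)
    {j : Fin l} {t : ℝ} (ht : t ∈ Set.Ioo (0 : ℝ) 1)
    (hs : D.IsSimple j t) :
    jump j t (densityFunction b w) = b j + ∑ q : D.Crossing × Bool,
      if (D.pass q.1 q.2).2 < t then
        (if (D.pass q.1 q.2).1 = j then passBreak q.2 (w q.1) else 0) else 0 := by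
  obtain ⟨L, R, hLR, -⟩ := hs.exists_sides
  have hsd := hLR.self_of_nhds
  rw [hsd.jump_eq]
  have h1 : Filter.Tendsto (fun ε : ℝ =>
      linkIntegral b w (D.curve j t + ε * (Complex.I * deriv (D.curve j) t)) -
        linkIntegral b w (D.curve j t - ε * (Complex.I * deriv (D.curve j) t)))
      (𝓝[>] 0) (𝓝 (2 * Real.pi * Complex.I * (densityFunction b w L - densityFunction b w R))) := by
    refine tendsto_const_nhds.congr' ?_
    filter_upwards [hsd] with ε hε
    rw [linkIntegral_eq b hw hε.1, linkIntegral_eq b hw hε.2]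
    ring
  have h2 := tendsto_finsetSum Finset.univ fun (i : Fin l) _ =>
    (tendsto_cauchyIntegral_curve ht hs i (a := 0) ⟨le_rfl, zero_lt_one⟩
      fun _ => ht.1.ne).const_mul (b i)
  have h3 := tendsto_finsetSum Finset.univ fun (q : D.Crossing × Bool) _ =>
    (tendsto_cauchyIntegral_curve ht hs (D.pass q.1 q.2).1 (pass_mem q.1 q.2)
      fun h1 h2 => hs q.1 q.2 (Prod.ext h1
        (h2.trans (Int.fract_eq_self.2 ⟨ht.1.le, ht.2⟩).symm))).const_mul
          (passBreak q.2 (w q.1))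
  have h4 := tendsto_nhds_unique h1 ((h2.add h3).congr fun ε => by
    simp only [linkIntegral, mul_sub, Finset.sum_sub_distrib]
    ring)
  apply mul_left_cancel₀ Complex.two_pi_I_ne_zero
  rw [h4, mul_add, Finset.mul_sum]
  congr 1
  · rw [Finset.sum_eq_single j]
    · simp [ht.1]
      ring
    · intro i _ hi
      simp [hi]
    · simp
  · refine Finset.sum_congr rfl fun q _ => ?_
    by_cases h5 : (D.pass q.1 q.2).1 = j <;> by_cases h6 : (D.pass q.1 q.2).2 < t <;>
      simp [h5, h6]
    ring

theorem eventually_isSimple [Finite D.Crossing] (i : Fin l) (t : ℝ) :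
    ∀ᶠ s in 𝓝[≠] t, s ∈ Set.Ico (0 : ℝ) 1 → D.IsSimple i s := by
  have h : ∀ᶠ s in 𝓝[≠] t, ∀ q : D.Crossing × Bool, (D.pass q.1 q.2).2 ≠ s := by
    rw [Filter.eventually_all]
    intro q
    by_cases hq : (D.pass q.1 q.2).2 = t
    · filter_upwards [self_mem_nhdsWithin] with s hs he
      exact hs (he.symm.trans hq)
    · filter_upwards [nhdsWithin_le_nhds (isOpen_ne.mem_nhds (Ne.symm hq))] with s hs he
      exact hs he.symm
  filter_upwards [h] with s hs hm c b hp
  rw [Int.fract_eq_self.2 hm] at hp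
  exact hs (c, b) (by rw [hp])

variable (D) in
theorem exists_isSimple [Finite D.Crossing] (i : Fin l) :
    ∃ t ∈ Set.Ioo (0 : ℝ) 1, D.IsSimple i t := by
  have h1 : ∀ᶠ s in 𝓝[≠] (1 / 2 : ℝ), s ∈ Set.Ioo (0 : ℝ) 1 :=
    nhdsWithin_le_nhds (isOpen_Ioo.mem_nhds (by norm_num))
  obtain ⟨s, h2, h3⟩ := (h1.and (eventually_isSimple (D := D) i (1 / 2))).exists
  exact ⟨s, h2, h3 (Set.Ioo_subset_Ico_self h2)⟩

/-- The partial sums at `t` and slightly after `t` differ exactly by the terms located at `t`. -/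
theorem eq_zero_of_partial_sums {ι : Type*} [Fintype ι] {τ : ι → ℝ} {δ : ι → ℂ}
    (h : ∀ t ∈ Set.Icc (0 : ℝ) 1, (∑ q, if τ q < t then δ q else 0) = 0) {t : ℝ}
    (ht : t ∈ Set.Ico (0 : ℝ) 1) : (∑ q, if τ q = t then δ q else 0) = 0 := by
  have h1 : ∀ᶠ s in 𝓝[>] t, ∀ q, t < τ q → s < τ q := by
    rw [Filter.eventually_all]
    intro q
    rw [Filter.eventually_imp_distrib_left]
    exact fun hq => nhdsWithin_le_nhds (gt_mem_nhds hq)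
  have h2 : ∀ᶠ s in 𝓝[>] t, s < 1 := nhdsWithin_le_nhds (gt_mem_nhds ht.2)
  obtain ⟨s, h3, h4, h5⟩ := (h1.and (h2.and self_mem_nhdsWithin)).exists
  have h6 : t < s := h5
  have h7 := h s ⟨ht.1.trans h6.le, h4.le⟩
  have h8 := h t (Set.Ico_subset_Icc_self ht)
  have h9 := h7.trans h8.symm
  rw [← sub_eq_zero, ← Finset.sum_sub_distrib] at h9
  refine Eq.trans ?_ h9
  refine Finset.sum_congr rfl fun q _ => ?_
  rcases lt_trichotomy (τ q) t with hq | hq | hq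
  · simp [hq, hq.ne, hq.trans h6]
  · simp [hq, h6]
  · simp [hq.ne', hq.not_gt, (h3 q hq).not_gt]

/-- The jump of `u` is described twice: by its own corner sums and by the density with breaks `w`.
Comparing partial sums makes the breaks agree, and the underpass of `c` isolates the value at `c`.
-/
theorem cornerSum_densityFunction [Fintype D.Crossing] (b : Fin l → ℂ) {w : D.Crossing → ℂ}
    (hw : ∀ i, (∑ q : D.Crossing × Bool,
      if (D.pass q.1 q.2).1 = i then passBreak q.2 (w q.1) else 0) = 0) :
    D.cornerSum (densityFunction b w) = w := by
  classical
  set u := densityFunction b w with hu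
  have hb : ∀ (b : Bool) (x y : ℂ), passBreak b (x - y) = passBreak b x - passBreak b y := by
    intro b x y
    cases b <;> simp [passBreak]
    ring
  have key : ∀ i, ∀ t ∈ Set.Icc (0 : ℝ) 1, (∑ q : D.Crossing × Bool,
      if (D.pass q.1 q.2).2 < t then
        (if (D.pass q.1 q.2).1 = i then passBreak q.2 (D.cornerSum u q.1 - w q.1) else 0)
        else 0) = 0 := by
    intro i
    obtain ⟨hsum, x₀, hx₀⟩ := exists_jump_eq u i
    have hdiff : ∀ t, (∑ q : D.Crossing × Bool, if (D.pass q.1 q.2).2 < t then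
        (if (D.pass q.1 q.2).1 = i then passBreak q.2 (D.cornerSum u q.1 - w q.1) else 0) else 0) =
        (∑ q : D.Crossing × Bool, if (D.pass q.1 q.2).2 < t then
        (if (D.pass q.1 q.2).1 = i then passBreak q.2 (D.cornerSum u q.1) else 0) else 0) -
        (∑ q : D.Crossing × Bool, if (D.pass q.1 q.2).2 < t then
        (if (D.pass q.1 q.2).1 = i then passBreak q.2 (w q.1) else 0) else 0) := by
      intro t
      rw [← Finset.sum_sub_distrib]
      refine Finset.sum_congr rfl fun q _ => ?_
      split_ifs <;> simp [hb]
    have h1 : ∀ t ∈ Set.Ioc (0 : ℝ) 1, x₀ - b i + (∑ q : D.Crossing × Bool,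
        if (D.pass q.1 q.2).2 < t then
          (if (D.pass q.1 q.2).1 = i then passBreak q.2 (D.cornerSum u q.1 - w q.1) else 0)
          else 0) = 0 := by
      intro t ht
      have e1 := hx₀ t ⟨ht.1.le, ht.2⟩
      have e2 : ∀ᶠ s in 𝓝[<] t, s ∈ Set.Ico (0 : ℝ) 1 → D.IsSimple i s :=
        (eventually_isSimple (D := D) i t).filter_mono
          (nhdsWithin_mono t fun s hs => ne_of_lt hs)
      have e3 : ∀ᶠ s in 𝓝[<] t, 0 < s := nhdsWithin_le_nhds (lt_mem_nhds ht.1)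
      have e4 : ∀ᶠ s in 𝓝[<] t, ∀ q : D.Crossing × Bool,
          (D.pass q.1 q.2).2 < t → (D.pass q.1 q.2).2 < s := by
        rw [Filter.eventually_all]
        intro q
        rw [Filter.eventually_imp_distrib_left]
        exact fun hq => nhdsWithin_le_nhds (lt_mem_nhds hq)
      obtain ⟨s, f1, f2, f3, f4, f5⟩ := (e1.and (e2.and (e3.and (e4.and
        self_mem_nhdsWithin)))).exists
      have f6 : s < t := f5
      have f7 : s < 1 := f6.trans_le ht.2
      rw [jump_densityFunction b hw ⟨f3, f7⟩ (f2 ⟨f3.le, f7⟩)] at f1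
      have f8 : (∑ q : D.Crossing × Bool, if (D.pass q.1 q.2).2 < s then
          (if (D.pass q.1 q.2).1 = i then passBreak q.2 (w q.1) else 0) else 0) =
          ∑ q : D.Crossing × Bool, if (D.pass q.1 q.2).2 < t then
          (if (D.pass q.1 q.2).1 = i then passBreak q.2 (w q.1) else 0) else 0 := by
        refine Finset.sum_congr rfl fun q _ => ?_
        have : (D.pass q.1 q.2).2 < s ↔ (D.pass q.1 q.2).2 < t := ⟨fun h => h.trans f6, f4 q⟩
        simp only [this]
      rw [f8] at f1
      rw [hdiff]
      linear_combination -f1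
    -- At `t = 1` all breaks of the component are counted, and both totals vanish.
    have h2 : x₀ - b i = 0 := by
      have h3 := h1 1 ⟨zero_lt_one, le_rfl⟩
      rw [hdiff, Finset.sum_congr rfl fun q _ => if_pos (pass_mem q.1 q.2).2,
        Finset.sum_congr (f := fun q : D.Crossing × Bool => if (D.pass q.1 q.2).2 < 1 then
          (if (D.pass q.1 q.2).1 = i then passBreak q.2 (w q.1) else 0) else 0) rfl
          fun q _ => if_pos (pass_mem q.1 q.2).2, hsum, hw] at h3
      simpa using h3
    intro t ht
    rcases ht.1.eq_or_lt with rfl | h0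
    · exact Finset.sum_eq_zero fun q _ => if_neg (pass_mem q.1 q.2).1.not_gt
    · have := h1 t ⟨h0, ht.2⟩
      rwa [h2, zero_add] at this
  ext c
  have h1 := eq_zero_of_partial_sums (τ := fun q : D.Crossing × Bool => (D.pass q.1 q.2).2)
    (key c.underpass.1) c.underpass_mem
  rw [Finset.sum_eq_single (c, false)] at h1
  · simpa [pass, passBreak, sub_eq_zero] using h1
  · intro q _ hq
    by_cases h2 : (D.pass q.1 q.2).2 = c.underpass.2
    · rw [if_pos h2]
      refine if_neg fun h3 => hq ?_
      obtain ⟨h4, h5⟩ := pass_injective (b' := false) (Prod.ext h3 h2 : D.pass q.1 q.2 = _)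
      exact Prod.ext h4 h5
    · exact if_neg h2
  · simp

theorem jump_const (i : Fin l) (t : ℝ) (x : ℂ) :
    jump i t (fun _ : D.regions (id : ℂ → ℂ) => x) = 0 := by
  by_cases hex : ∃ L R : D.regions (id : ℂ → ℂ), D.Sides i t L R
  · obtain ⟨L, R, h⟩ := hex
    rw [h.jump_eq, sub_self]
  · rw [jump, dif_neg hex, LinearMap.zero_apply]

theorem cornerSum_const (x : ℂ) : D.cornerSum (fun _ => x) = 0 := by
  ext c
  rw [cornerSum_apply]
  simp

theorem exists_function_on_regions [Fintype D.Crossing] {base : Fin l → ℝ}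
    (hbase : ∀ i, base i ∈ Set.Ioo (0 : ℝ) 1) (hsimple : ∀ i, D.IsSimple i (base i))
    (R₀ : D.regions (id : ℂ → ℂ)) (x : ℂ) (a : Fin l → ℂ) {w : D.Crossing → ℂ}
    (hw : ∀ i, (∑ q : D.Crossing × Bool,
      if (D.pass q.1 q.2).1 = i then passBreak q.2 (w q.1) else 0) = 0) :
    ∃ u, u R₀ = x ∧ (∀ i, jump i (base i) u = a i) ∧ D.cornerSum u = w := by
  -- The density at parameter `0` is the prescribed jump minus the breaks before the base point. A
  -- constant added afterwards adjusts the value on `R₀` without changing any jump.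
  set b : Fin l → ℂ := fun i => a i - ∑ q : D.Crossing × Bool,
    if (D.pass q.1 q.2).2 < base i then
      (if (D.pass q.1 q.2).1 = i then passBreak q.2 (w q.1) else 0) else 0 with hb
  refine ⟨densityFunction b w + fun _ => x - densityFunction b w R₀, ?_, fun i => ?_, ?_⟩
  · simp
  · rw [map_add, jump_const, add_zero, jump_densityFunction b hw (hbase i) (hsimple i), hb]
    simp
  · rw [map_add, cornerSum_const, add_zero, cornerSum_densityFunction b hw]

end LinkDiagram

/-! ### Ranks of integer matrices -/

/-- Integer vectors are independent over `ℤ` exactly when they are over `ℂ`. Applied to a maximal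
independent set of columns and to a `ℤ`-basis of the range, this yields the two inequalities. -/
theorem Matrix.rank_map_intCast {m n : Type*} [Finite m] [Fintype n]
    (A : Matrix m n ℤ) : (A.map (Int.cast : ℤ → ℂ)).rank = A.rank := by
  classical
  have := Fintype.ofFinite m
  have hcast : ∀ v : n → ℤ, (A.map (Int.cast : ℤ → ℂ)).mulVec (fun j => (v j : ℂ)) =
      fun i => ((A.mulVec v i : ℤ) : ℂ) := by
    intro v
    ext i
    simp [Matrix.mulVec, dotProduct]
  apply le_antisymm
  · rw [Matrix.rank_eq_finrank_span_cols]
    obtain ⟨κ, a, ha, hspan, hli⟩ := exists_linearIndependent' ℂ (A.map (Int.cast : ℤ → ℂ)).col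
    have := Finite.of_injective a ha
    have := Fintype.ofFinite κ
    rw [← hspan, finrank_span_eq_card hli]
    have h2 : LinearIndependent ℤ (A.col ∘ a) := by
      apply (linearIndependent_algebraMap_comp_iff (S := ℂ) (v := A.col ∘ a)).1
      exact hli
    rw [Matrix.rank_eq_finrank_span_cols]
    have h3 : LinearIndependent ℤ fun k =>
        (⟨A.col (a k), Submodule.subset_span ⟨a k, rfl⟩⟩ :
          Submodule.span ℤ (Set.range A.col)) :=
      LinearIndependent.of_comp (Submodule.subtype _) h2
    exact h3.fintype_card_le_finrank
  · let b := Module.finBasis ℤ (LinearMap.range A.mulVecLin)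
    have h1 : LinearIndependent ℤ fun k => ((b k : LinearMap.range A.mulVecLin) : m → ℤ) :=
      b.linearIndependent.map' (Submodule.subtype _) (Submodule.ker_subtype _)
    have h2 := (linearIndependent_algebraMap_comp_iff (S := ℂ)).2 h1
    have h3 : ∀ k, (fun i => (((b k : LinearMap.range A.mulVecLin) : m → ℤ) i : ℂ)) ∈
        LinearMap.range (A.map (Int.cast : ℤ → ℂ)).mulVecLin := by
      intro k
      obtain ⟨v, hv⟩ := (b k).2
      refine ⟨fun j => (v j : ℂ), ?_⟩
      rw [Matrix.mulVecLin_apply, hcast, ← hv]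
      rfl
    have h4 : LinearIndependent ℂ fun k =>
        (⟨_, h3 k⟩ : LinearMap.range (A.map (Int.cast : ℤ → ℂ)).mulVecLin) :=
      LinearIndependent.of_comp (Submodule.subtype _) h2
    have := h4.fintype_card_le_finrank
    rwa [Fintype.card_fin] at this

theorem Matrix.finrank_ker_mulVecLin_add_rank {R : Type*} {m n : Type} [CommRing R] [IsDomain R]
    [Fintype n] (A : Matrix m n R) :
    Module.finrank R (LinearMap.ker A.mulVecLin) + A.rank = Fintype.card n := by
  rw [Matrix.rank, ← A.mulVecLin.quotKerEquivRange.finrank_eq, add_comm,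
    Submodule.finrank_quotient_add_finrank, Module.finrank_fintype_fun_eq_card]

/-! ### The graph of components and crossings, and Euler's formula -/

namespace LinkDiagram

variable {l : ℕ} {D : LinkDiagram l}

variable (D) in
open Classical in
/-- The incidence matrix of the graph whose vertices are the components of the link and whose edges
are the crossings. -/
noncomputable def incidenceMatrix : Matrix (Fin l) D.Crossing ℂ := fun i c =>
  (if c.underpass.1 = i then 1 else 0) - if c.overpass.1 = i then 1 else 0

theorem incidenceMatrix_mulVec [Fintype D.Crossing] (w : D.Crossing → ℂ) (i : Fin l) :
    (D.incidenceMatrix.mulVec w) i = ∑ q : D.Crossing × Bool,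
      if (D.pass q.1 q.2).1 = i then passBreak q.2 (w q.1) else 0 := by
  rw [Fintype.sum_prod_type, Matrix.mulVec, dotProduct]
  refine Finset.sum_congr rfl fun c _ => ?_
  rw [Fintype.sum_bool]
  by_cases h1 : c.underpass.1 = i <;> by_cases h2 : c.overpass.1 = i <;>
    simp [incidenceMatrix, h1, h2, pass, passBreak]

theorem incidenceMatrix_transpose_mulVec (φ : Fin l → ℂ) (c : D.Crossing) :
    (D.incidenceMatrix.transpose.mulVec φ) c = φ c.underpass.1 - φ c.overpass.1 := by
  simp [Matrix.mulVec, dotProduct, incidenceMatrix, sub_mul, Finset.sum_sub_distrib]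

/-- The connected component of the projection image that contains a component of the link. -/
noncomputable def imageComponent (i : Fin l) : components D.image :=
  ⟨connectedComponentIn D.image (D.curve i 0), _, D.curve_mem_image i 0, rfl⟩

theorem isPreconnected_range_curve (i : Fin l) : IsPreconnected (Set.range (D.curve i)) :=
  isPreconnected_range (D.continuous_curve i)

theorem imageComponent_coe (i : Fin l) (t : ℝ) :
    (imageComponent (D := D) i : Set ℂ) = connectedComponentIn D.image (D.curve i t) := by
  apply connectedComponentIn_eq
  refine (isPreconnected_range_curve i).subset_connectedComponentIn ⟨0, rfl⟩ ?_ ⟨t, rfl⟩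
  rintro _ ⟨s, rfl⟩
  exact D.curve_mem_image i s

theorem imageComponent_surjective : Function.Surjective (imageComponent (D := D)) := by
  rintro ⟨_, z, hz, rfl⟩
  obtain ⟨i, t, rfl⟩ := D.exists_curve_eq hz
  exact ⟨i, Subtype.ext (imageComponent_coe i t)⟩

/-- Distinct components through a common point meet at a crossing, so `φ` descends to a function on
the projection image. It is locally constant there, since near a point only components through that
point occur. -/
theorem eq_of_imageComponent_eq {φ : Fin l → ℂ}
    (hφ : ∀ c : D.Crossing, φ c.underpass.1 = φ c.overpass.1) {i j : Fin l}
    (h : imageComponent (D := D) i = imageComponent j) : φ i = φ j := by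
  have hwd : ∀ i j s t, D.curve i s = D.curve j t → φ i = φ j := by
    intro i j s t hst
    by_cases hij : i = j
    · rw [hij]
    · obtain ⟨c, b, h1, h2⟩ := exists_pass_eq (D := D) (fract_mem i s) (fract_mem j t)
        (fun h => hij (Prod.ext_iff.1 h).1) (by
          change D.curve i _ = D.curve j _
          rw [D.curve_fract, D.curve_fract, hst])
      have h3 := hφ c
      cases b
      · change c.underpass = _ at h1
        change c.overpass = _ at h2
        rwa [h1, h2] at h3
      · change c.overpass = _ at h1
        change c.underpass = _ at h2
        rw [h1, h2] at h3
        exact h3.symm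
  classical
  set g : ℂ → ℂ := fun z => if hz : ∃ i t, D.curve i t = z then φ hz.choose else 0 with hg
  have hgc : ∀ i t, g (D.curve i t) = φ i := by
    intro i t
    have hex : ∃ j s, D.curve j s = D.curve i t := ⟨i, t, rfl⟩
    simp only [hg]
    rw [dif_pos hex]
    exact hwd _ _ _ _ hex.choose_spec.choose_spec
  have hloc : ∀ z ∈ connectedComponentIn D.image (D.curve i 0),
      ∀ᶠ z' in 𝓝[connectedComponentIn D.image (D.curve i 0)] z, g z' = g z := by
    intro z hz
    have h1 : ∀ᶠ z' in 𝓝 z, ∀ i t, D.curve i t = z' → t ∈ {_t : ℝ | g z = φ i} := by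
      -- Each of these sets is all of `ℝ` or empty: it selects components, not parameters.
      refine eventually_parameter_mem (D := D) (U := fun i => {_t : ℝ | g z = φ i})
        (fun i => ?_) (fun i t k h => h) fun i t h => ?_
      · by_cases hi : g z = φ i <;> simp [hi]
      · rw [← h]
        exact hgc i t
    filter_upwards [nhdsWithin_le_nhds h1, self_mem_nhdsWithin] with z' h2 h3
    obtain ⟨k, t, hk⟩ := D.exists_curve_eq (connectedComponentIn_subset _ _ h3)
    have h4 : g z = φ k := h2 k t hk
    rw [h4, ← hk, hgc]
  have hj : D.curve j 0 ∈ connectedComponentIn D.image (D.curve i 0) := by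
    rw [← imageComponent_coe i 0, h, imageComponent_coe j 0]
    exact mem_connectedComponentIn (D.curve_mem_image j 0)
  have hi := mem_connectedComponentIn (D.curve_mem_image i 0)
  rw [← hgc i 0, ← hgc j 0]
  exact isPreconnected_connectedComponentIn.eq_of_eventually_eq hloc hi hj

theorem imageComponent_overpass_eq (c : D.Crossing) :
    imageComponent (D := D) c.underpass.1 = imageComponent c.overpass.1 := by
  apply Subtype.ext
  rw [imageComponent_coe _ c.underpass.2, imageComponent_coe _ c.overpass.2]
  exact congrArg _ c.proj_eq.symm

theorem ker_incidenceMatrix_transpose [Fintype D.Crossing] :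
    LinearMap.ker D.incidenceMatrix.transpose.mulVecLin =
      LinearMap.range (LinearMap.funLeft ℂ ℂ (imageComponent (D := D))) := by
  ext φ
  rw [LinearMap.mem_ker, Matrix.mulVecLin_apply, LinearMap.mem_range]
  constructor
  · intro h
    have hφ : ∀ c : D.Crossing, φ c.underpass.1 = φ c.overpass.1 := fun c => by
      have := congrFun h c
      rwa [incidenceMatrix_transpose_mulVec, Pi.zero_apply, sub_eq_zero] at this
    refine ⟨fun C => φ (imageComponent_surjective C).choose, ?_⟩
    ext i
    exact eq_of_imageComponent_eq hφ (imageComponent_surjective (imageComponent i)).choose_spec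
  · rintro ⟨f, rfl⟩
    ext c
    rw [incidenceMatrix_transpose_mulVec]
    simp [LinearMap.funLeft_apply, imageComponent_overpass_eq]

/-- Rank-nullity is applied to the matrix and to its transpose, whose ranks agree; the transpose has
nullity equal to the number of components of the image. -/
theorem finrank_ker_incidenceMatrix [Fintype D.Crossing] :
    Module.finrank ℂ (LinearMap.ker D.incidenceMatrix.mulVecLin) + l =
      Fintype.card D.Crossing + (components D.image).ncard := by
  have := Finite.of_surjective _ (imageComponent_surjective (D := D))
  have := Fintype.ofFinite (components D.image)
  have h1 := D.incidenceMatrix.finrank_ker_mulVecLin_add_rank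
  have h2 := D.incidenceMatrix.transpose.finrank_ker_mulVecLin_add_rank
  rw [ker_incidenceMatrix_transpose, LinearMap.finrank_range_of_inj
    (LinearMap.funLeft_injective_of_surjective _ _ _ imageComponent_surjective),
    Module.finrank_fintype_fun_eq_card, Matrix.rank_transpose, Fintype.card_fin] at h2
  rw [← Nat.card_coe_set_eq, Nat.card_eq_fintype_card]
  omega

theorem incidenceMatrix_mulVec_cornerSum [Fintype D.Crossing]
    (u : D.regions (id : ℂ → ℂ) → ℂ) :
    D.incidenceMatrix.mulVec (D.cornerSum u) = 0 := by
  ext i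
  rw [incidenceMatrix_mulVec]
  exact (exists_jump_eq u i).1

theorem exists_notMem_image (D : LinkDiagram l) : ∃ z, z ∉ D.image :=
  (frequently_notMem_image 0).exists

variable (D) in
-- The coordinates are the value on one region, the jump at a simple base point of each component,
-- and the corner sum. Injectivity is the constancy of functions without jumps; surjectivity is the
-- Cauchy integral construction.
theorem exists_equiv [Fintype D.Crossing] :
    ∃ e : (D.regions (id : ℂ → ℂ) → ℂ) ≃ₗ[ℂ] ℂ × (Fin l → ℂ) ×
      LinearMap.ker D.incidenceMatrix.mulVecLin, ∀ u, ((e u).2.2 : D.Crossing → ℂ) =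
        D.cornerSum u := by
  choose base hbase hsimple using D.exists_isSimple
  obtain ⟨z, hz⟩ := D.exists_notMem_image
  obtain ⟨R₀, -⟩ := exists_region_mem hz
  let T : (D.regions (id : ℂ → ℂ) → ℂ) →ₗ[ℂ] ℂ × (Fin l → ℂ) ×
      LinearMap.ker D.incidenceMatrix.mulVecLin :=
    (LinearMap.proj (R := ℂ) (φ := fun _ => ℂ) R₀).prod
      ((LinearMap.pi fun i => jump i (base i)).prod
        (D.cornerSum.codRestrict _ fun u => incidenceMatrix_mulVec_cornerSum u))
  have hT : Function.Bijective T := by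
    constructor
    · rw [injective_iff_map_eq_zero]
      intro u hu
      obtain ⟨h1, h2⟩ := Prod.ext_iff.1 hu
      obtain ⟨h3, h4⟩ := Prod.ext_iff.1 h2
      have h5 : D.cornerSum u = 0 := congrArg Subtype.val h4
      ext R
      rw [eq_of_cornerSum_eq_zero h5 (fun i => Set.Ioo_subset_Icc_self (hbase i)) hsimple
        (fun i => congrFun h3 i) R R₀]
      exact h1
    · rintro ⟨x, a, w, hw⟩
      obtain ⟨u, h1, h2, h3⟩ := exists_function_on_regions hbase hsimple R₀ x a (w := w)
        fun i => by
          rw [← incidenceMatrix_mulVec]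
          exact congrFun hw i
      exact ⟨u, Prod.ext h1 (Prod.ext (funext h2) (Subtype.ext h3))⟩
  exact ⟨LinearEquiv.ofBijective T hT, fun u => rfl⟩

instance finite_regions [Finite D.Crossing] : Finite (D.regions (id : ℂ → ℂ)) := by
  have := Fintype.ofFinite D.Crossing
  obtain ⟨e, -⟩ := D.exists_equiv
  have : Module.Finite ℂ (D.regions (id : ℂ → ℂ) → ℂ) := Module.Finite.equiv e.symm
  -- The finitely supported functions embed in a finite-dimensional space, which forces the index
  -- set to be finite.
  have : Module.Finite ℂ (D.regions (id : ℂ → ℂ) →₀ ℂ) :=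
    Module.Finite.of_injective (Finsupp.lcoeFun (R := ℂ)) DFunLike.coe_injective
  rcases Module.finite_finsupp_self_iff.1 this with h | h
  · exact (not_subsingleton ℂ h).elim
  · exact h

/-- Euler's formula for link diagrams. -/
theorem ncard_regions [Fintype D.Crossing] :
    (D.regions (id : ℂ → ℂ)).ncard = Fintype.card D.Crossing + (components D.image).ncard + 1 := by
  obtain ⟨e, -⟩ := D.exists_equiv
  have := Fintype.ofFinite (D.regions (id : ℂ → ℂ))
  have h := e.finrank_eq
  rw [Module.finrank_fintype_fun_eq_card, Module.finrank_prod, Module.finrank_prod,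
    Module.finrank_fintype_fun_eq_card, Module.finrank_self, Fintype.card_fin] at h
  have h2 := finrank_ker_incidenceMatrix (D := D)
  rw [← Nat.card_coe_set_eq, Nat.card_eq_fintype_card, h]
  omega

theorem finrank_range_cornerSum [Fintype D.Crossing] :
    Module.finrank ℂ (LinearMap.range D.cornerSum) + l =
      Fintype.card D.Crossing + (components D.image).ncard := by
  have h : LinearMap.range D.cornerSum = LinearMap.ker D.incidenceMatrix.mulVecLin := by
    obtain ⟨e, he⟩ := D.exists_equiv
    ext w
    constructor
    · rintro ⟨u, rfl⟩
      exact incidenceMatrix_mulVec_cornerSum u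
    · intro hw
      refine ⟨e.symm (0, 0, ⟨w, hw⟩), ?_⟩
      rw [← he, LinearEquiv.apply_symm_apply]
  rw [h, finrank_ker_incidenceMatrix]

end LinkDiagram

/-! ### Regions on the sphere -/

theorem isPreconnected_setOf_lt_norm {ρ : ℝ} (hρ : 0 < ρ) :
    IsPreconnected {z : ℂ | ρ < ‖z‖} := by
  have h : {z : ℂ | ρ < ‖z‖} = Complex.exp '' {w | Real.log ρ < w.re} := by
    ext z
    constructor
    · intro hz
      have hz' : ρ < ‖z‖ := hz
      have h0 : z ≠ 0 := norm_pos_iff.1 (hρ.trans hz')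
      refine ⟨Complex.log z, ?_, Complex.exp_log h0⟩
      change Real.log ρ < (Complex.log z).re
      rw [Complex.log_re]
      exact Real.log_lt_log hρ hz'
    · rintro ⟨w, hw, rfl⟩
      change ρ < ‖Complex.exp w‖
      rw [Complex.norm_exp]
      exact (Real.log_lt_iff_lt_exp hρ).1 hw
  rw [h]
  exact (convex_halfSpace_re_gt (Real.log ρ)).isPreconnected.image _
    Complex.continuous_exp.continuousOn

namespace LinkDiagram

variable {l : ℕ} {D : LinkDiagram l}

variable (D) in
theorem exists_exterior_region : ∃ R : D.regions (id : ℂ → ℂ), ∃ E : Set ℂ,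
    E ⊆ R ∧ IsPreconnected E ∧ E ∈ Filter.coclosedCompact ℂ := by
  obtain ⟨ρ, hρ, hsub⟩ := D.isCompact_image.isBounded.subset_closedBall_lt 0 (0 : ℂ)
  have hE : {z : ℂ | ρ < ‖z‖} = (Metric.closedBall (0 : ℂ) ρ)ᶜ := by
    ext z
    simp
  have hcc : {z : ℂ | ρ < ‖z‖} ∈ Filter.coclosedCompact ℂ := by
    rw [hE]
    exact (isCompact_closedBall (0 : ℂ) ρ).compl_mem_coclosedCompact_of_isClosed
      Metric.isClosed_closedBall
  obtain ⟨R, hR⟩ := exists_region_superset (D := D) (isPreconnected_setOf_lt_norm hρ)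
    (Filter.nonempty_of_mem hcc) (by rw [hE]; exact Set.compl_subset_compl.2 hsub)
  exact ⟨R, _, hR, isPreconnected_setOf_lt_norm hρ, hcc⟩

theorem some_notMem {z : ℂ} (hz : z ∉ D.image) :
    (OnePoint.some z : OnePoint ℂ) ∈ (OnePoint.some '' D.image)ᶜ := by
  rintro ⟨w, hw, h⟩
  exact hz (OnePoint.coe_injective h ▸ hw)

/-- Adding `∞` merges no regions: a neighbourhood of `∞` meets only the exterior region `R'`. Hence
sending each point to its region, and `∞` to `R'`, is locally constant on the complement in the
sphere. -/
theorem preimage_connectedComponentIn {z : ℂ} (hz : z ∉ D.image) :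
    (OnePoint.some : ℂ → OnePoint ℂ) ⁻¹'
      connectedComponentIn (OnePoint.some '' D.image)ᶜ (OnePoint.some z) =
      connectedComponentIn D.imageᶜ z := by
  classical
  apply Set.Subset.antisymm
  · obtain ⟨R', E, hER, -, hE⟩ := D.exists_exterior_region
    choose reg hreg using fun (w : ℂ) (hw : w ∉ D.image) => exists_region_mem (D := D) hw
    let f : OnePoint ℂ → D.regions (id : ℂ → ℂ) := fun x =>
      x.elim R' fun w => if hw : w ∉ D.image then reg w hw else R'
    have hf : ∀ {w : ℂ} {R : D.regions (id : ℂ → ℂ)}, w ∈ (R : Set ℂ) →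
        f (OnePoint.some w) = R := fun {w R} hw => by
      have h1 : w ∉ D.image := region_subset R hw
      change (if hw : w ∉ D.image then reg w hw else R') = R
      rw [dif_pos h1]
      exact region_eq (hreg w h1) hw
    have hfi : f OnePoint.infty = R' := rfl
    have hloc : ∀ x ∈ connectedComponentIn (OnePoint.some '' D.image)ᶜ (OnePoint.some z),
        ∀ᶠ y in 𝓝[connectedComponentIn (OnePoint.some '' D.image)ᶜ (OnePoint.some z)] x,
          f y = f x := by
      intro x hx
      apply nhdsWithin_le_nhds
      induction x using OnePoint.rec with
      | infty =>
        rw [OnePoint.nhds_infty_eq, hfi]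
        refine Filter.mem_sup.2 ⟨?_, hfi⟩
        rw [Filter.mem_map]
        filter_upwards [hE] with w hw
        exact hf (hER hw)
      | coe w =>
        have hw : w ∉ D.image := fun hw => connectedComponentIn_subset _ _ hx ⟨w, hw, rfl⟩
        obtain ⟨R, hR⟩ := exists_region_mem hw
        rw [OnePoint.nhds_coe_eq, hf hR]
        refine Filter.mem_map.2 ?_
        filter_upwards [(isOpen_region R).mem_nhds hR] with w' hw'
        exact hf hw'
    intro w hw
    have hw' : w ∉ D.image := fun h => connectedComponentIn_subset _ _ hw ⟨w, h, rfl⟩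
    obtain ⟨R, hR⟩ := exists_region_mem hw'
    have h1 := isPreconnected_connectedComponentIn.eq_of_eventually_eq hloc
      (mem_connectedComponentIn (some_notMem hz)) hw
    let R₀ : D.regions (id : ℂ → ℂ) := ⟨_, mem_regions_iff.2 ⟨z, hz, rfl⟩⟩
    rw [hf (R := R₀) (mem_connectedComponentIn hz), hf hR] at h1
    have h2 : w ∈ (R₀ : Set ℂ) := h1 ▸ hR
    exact h2
  · rw [← Set.image_subset_iff]
    refine IsPreconnected.subset_connectedComponentIn ?_ ?_ ?_
    · exact isPreconnected_connectedComponentIn.image _ OnePoint.continuous_coe.continuousOn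
    · exact ⟨z, mem_connectedComponentIn hz, rfl⟩
    · rintro _ ⟨w, hw, rfl⟩
      exact some_notMem (connectedComponentIn_subset _ _ hw)

theorem exists_eq_connectedComponentIn_some {S : Set (OnePoint ℂ)}
    (hS : S ∈ D.regions (OnePoint.some : ℂ → OnePoint ℂ)) :
    ∃ z, z ∉ D.image ∧
      S = connectedComponentIn (OnePoint.some '' D.image)ᶜ (OnePoint.some z) := by
  obtain ⟨x, hx, rfl⟩ := hS
  induction x using OnePoint.rec with
  | coe z => exact ⟨z, fun hz => hx ⟨z, hz, rfl⟩, rfl⟩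
  | infty =>
    obtain ⟨R', E, hER, hEc, hE⟩ := D.exists_exterior_region
    obtain ⟨z, hz⟩ := Filter.nonempty_of_mem hE
    refine ⟨z, region_subset R' (hER hz), connectedComponentIn_eq ?_⟩
    -- `∞` is a limit of the connected exterior set `E`, so its component contains finite points.
    have hcl : OnePoint.infty ∈ closure ((OnePoint.some : ℂ → OnePoint ℂ) '' E) := by
      apply mem_closure_of_tendsto OnePoint.tendsto_coe_infty
      filter_upwards [hE] with w hw
      exact ⟨w, hw, rfl⟩
    have hpre : IsPreconnected (insert OnePoint.infty ((OnePoint.some : ℂ → OnePoint ℂ) '' E)) :=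
      (hEc.image _ OnePoint.continuous_coe.continuousOn).subset_closure
        (Set.subset_insert _ _) (Set.insert_subset hcl subset_closure)
    refine hpre.subset_connectedComponentIn (Set.mem_insert _ _) ?_
      (Set.mem_insert_of_mem _ ⟨z, hz, rfl⟩)
    rintro y (rfl | ⟨w, hw, rfl⟩)
    · exact hx
    · exact some_notMem (region_subset R' (hER hw))

variable (D) in
/-- The regions of a diagram on the sphere correspond to its regions on the plane. -/
theorem exists_sphereRegions_equiv :
    ∃ e : D.regions (OnePoint.some : ℂ → OnePoint ℂ) ≃ D.regions (id : ℂ → ℂ),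
      ∀ S, (e S : Set ℂ) = OnePoint.some ⁻¹' (S : Set (OnePoint ℂ)) := by
  have hmem : ∀ S : D.regions (OnePoint.some : ℂ → OnePoint ℂ),
      (OnePoint.some : ℂ → OnePoint ℂ) ⁻¹' (S : Set (OnePoint ℂ)) ∈ D.regions (id : ℂ → ℂ) := by
    intro S
    obtain ⟨z, hz, hS⟩ := exists_eq_connectedComponentIn_some S.2
    rw [hS, preimage_connectedComponentIn hz]
    exact mem_regions_iff.2 ⟨z, hz, rfl⟩
  refine ⟨Equiv.ofBijective (fun S => ⟨_, hmem S⟩) ⟨?_, ?_⟩, fun S => rfl⟩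
  · intro S S' h
    obtain ⟨z, hz, hS⟩ := exists_eq_connectedComponentIn_some S.2
    obtain ⟨z', hz', hS'⟩ := exists_eq_connectedComponentIn_some S'.2
    have h1 : (OnePoint.some : ℂ → OnePoint ℂ) ⁻¹' (S : Set (OnePoint ℂ)) =
        OnePoint.some ⁻¹' (S' : Set (OnePoint ℂ)) := congrArg Subtype.val h
    have h2 : z ∈ (OnePoint.some : ℂ → OnePoint ℂ) ⁻¹' (S' : Set (OnePoint ℂ)) := by
      rw [← h1, hS]
      exact mem_connectedComponentIn (some_notMem hz)
    rw [hS'] at h2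
    apply Subtype.ext
    rw [hS, hS']
    exact (connectedComponentIn_eq h2).symm
  · intro R
    obtain ⟨z, hz, hR⟩ := mem_regions_iff.1 R.2
    refine ⟨⟨_, OnePoint.some z, some_notMem hz, rfl⟩, Subtype.ext ?_⟩
    rw [hR]
    exact preimage_connectedComponentIn hz

end LinkDiagram

/-! ### Ranks of the two region choice matrices -/

namespace LinkDiagram

variable {l : ℕ} {D : LinkDiagram l}

theorem touchesAt_iff (c : D.Crossing) (R : D.regions (id : ℂ → ℂ)) (ε δ : ℤˣ) :
    c.TouchesAt id (R : Set ℂ) ε δ ↔ R = c.cornerRegion ε δ := by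
  constructor
  · intro h
    obtain ⟨t, h1, h2⟩ := (h.and (c.cornerRegions.touches ε δ)).exists
    exact region_eq h1 h2
  · rintro rfl
    exact c.cornerRegions.touches ε δ

theorem alternatingMatrix_mulVec [Fintype (D.regions (id : ℂ → ℂ))]
    (u : D.regions (id : ℂ → ℂ) → ℂ) :
    ((D.alternatingMatrix id).map (Int.cast : ℤ → ℂ)).mulVec u = D.cornerSum u := by
  classical
  ext c
  simp only [Matrix.mulVec, dotProduct, Matrix.map_apply, alternatingMatrix, touchesAt_iff,
    Int.cast_sum, Finset.sum_mul]
  rw [Finset.sum_comm]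
  simp only [cornerSum, LinearMap.pi_apply, LinearMap.sum_apply]
  refine Finset.sum_congr rfl fun ε _ => ?_
  rw [Finset.sum_comm]
  refine Finset.sum_congr rfl fun δ _ => ?_
  rw [Finset.sum_eq_single (c.cornerRegion ε δ)]
  · simp
  · intro R _ hR
    simp [hR]
  · simp

theorem rank_alternatingMatrix [Fintype D.Crossing] [Fintype (D.regions (id : ℂ → ℂ))] :
    (D.alternatingMatrix id).rank + l =
      Fintype.card D.Crossing + (components D.image).ncard := by
  rw [← finrank_range_cornerSum, ← Matrix.rank_map_intCast, Matrix.rank]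
  have : ((D.alternatingMatrix id).map (Int.cast : ℤ → ℂ)).mulVecLin = D.cornerSum :=
    LinearMap.ext alternatingMatrix_mulVec
  rw [this]

/-- A checkerboard colouring of the regions by nonzero complex numbers: the colours at the corners
of each crossing alternate in sign. -/
theorem exists_checkerboard [Fintype D.Crossing] :
    ∃ χ : D.regions (id : ℂ → ℂ) → ℂ, (∀ R, χ R ≠ 0) ∧ ∀ (c : D.Crossing) (ε δ : ℤˣ),
      χ (c.cornerRegion ε δ) = ((ε * δ : ℤˣ) : ℤ) * χ (c.cornerRegion 1 1) := by
  have hw : ∀ i, (∑ q : D.Crossing × Bool,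
      if (D.pass q.1 q.2).1 = i then passBreak q.2 ((0 : D.Crossing → ℂ) q.1) else 0) = 0 :=
    fun i => Finset.sum_eq_zero fun q _ => by cases q.2 <;> simp [passBreak]
  -- Constant density one without breaks: `u` rises by one whenever the link is crossed from right
  -- to left, so `exp (πi u)` changes sign.
  set u : D.regions (id : ℂ → ℂ) → ℂ := densityFunction 1 0 with hu
  have hj : ∀ i, ∀ t ∈ Set.Ioo (0 : ℝ) 1, D.IsSimple i t → jump i t u = 1 := by
    intro i t ht hs
    rw [hu, jump_densityFunction 1 hw ht hs]
    simp [passBreak]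
  have hsum : D.cornerSum u = 0 := cornerSum_densityFunction 1 hw
  have hright : ∀ i, ∀ t ∈ Set.Ico (0 : ℝ) 1, ∀ᶠ s in 𝓝[>] t, jump i s u = 1 := by
    intro i t ht
    have h1 : ∀ᶠ s in 𝓝[>] t, s ∈ Set.Ico (0 : ℝ) 1 → D.IsSimple i s :=
      (eventually_isSimple (D := D) i t).filter_mono (nhdsWithin_mono t fun s hs => ne_of_gt hs)
    have h2 : ∀ᶠ s in 𝓝[>] t, s < 1 := nhdsWithin_le_nhds (gt_mem_nhds ht.2)
    filter_upwards [h1, h2, self_mem_nhdsWithin] with s f1 f2 f3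
    have f4 : 0 < s := ht.1.trans_lt f3
    exact hj i s ⟨f4, f2⟩ (f1 ⟨f4.le, f2⟩)
  refine ⟨fun R => Complex.exp (Real.pi * Complex.I * u R), fun R => Complex.exp_ne_zero _, ?_⟩
  intro c ε δ
  have hover : u (c.cornerRegion 1 c.orientation) - u (c.cornerRegion 1 (-c.orientation)) = 1 := by
    obtain ⟨s, h1, h2, h3⟩ := ((hright c.overpass.1 c.overpass.2 c.overpass_mem).and
      (((c.cornerRegions.over_sides 1).filter_mono nhdsWithin_le_nhds).and
        self_mem_nhdsWithin)).exists
    have h4 : c.overpass.2 < s := h3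
    rwa [(h2 (by simpa using h4)).jump_eq] at h1
  have hunder : u (c.cornerRegion (-c.orientation) 1) - u (c.cornerRegion c.orientation 1) = 1 := by
    obtain ⟨s, h1, h2, h3⟩ := ((hright c.underpass.1 c.underpass.2 c.underpass_mem).and
      (((c.cornerRegions.under_sides 1).filter_mono nhdsWithin_le_nhds).and
        self_mem_nhdsWithin)).exists
    have h4 : c.underpass.2 < s := h3
    rwa [(h2 (by simpa using h4)).jump_eq] at h1
  have hc := congrFun hsum c
  rw [cornerSum_apply, Pi.zero_apply] at hc
  have hplus : ∀ x y : ℂ, x - y = 1 →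
      Complex.exp (Real.pi * Complex.I * x) = -Complex.exp (Real.pi * Complex.I * y) := by
    intro x y h
    rw [show x = y + 1 by linear_combination h, mul_add, Complex.exp_add, mul_one,
      Complex.exp_pi_mul_I]
    ring
  rcases Int.units_eq_one_or c.orientation with h | h <;> rw [h] at hover hunder hc <;>
    simp only [neg_neg, Units.val_one, Units.val_neg, Int.cast_one, Int.cast_neg, neg_mul,
      one_mul, neg_eq_zero] at hover hunder hc
  · have h4 : u (c.cornerRegion (-1) (-1)) = u (c.cornerRegion 1 1) := by
      linear_combination hc - hover + hunder
    rcases Int.units_eq_one_or ε with rfl | rfl <;> rcases Int.units_eq_one_or δ with rfl | rfl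
    · simp
    · simp [hplus _ _ hover]
    · simp [hplus _ _ hunder]
    · simp [h4]
  · have h4 : u (c.cornerRegion (-1) (-1)) = u (c.cornerRegion 1 1) := by
      linear_combination hc + hover - hunder
    rcases Int.units_eq_one_or ε with rfl | rfl <;> rcases Int.units_eq_one_or δ with rfl | rfl
    · simp
    · simp [hplus _ _ hover]
    · simp [hplus _ _ hunder]
    · simp [h4]

/-- At each crossing the corner signs and the colours `χ` alternate in the same way, up to a nonzero
factor `η`. Rescaling columns by `χ` and rows by `η` therefore matches the two matrices. -/
theorem rank_definiteMatrix [Fintype D.Crossing] [Fintype (D.regions (id : ℂ → ℂ))] :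
    (D.definiteMatrix id).rank = (D.alternatingMatrix id).rank := by
  classical
  obtain ⟨χ, hχ, hcol⟩ := exists_checkerboard (D := D)
  set η : D.Crossing → ℂ := fun c => -((c.orientation : ℤ) : ℂ) * χ (c.cornerRegion 1 1) with hη
  have hη0 : ∀ c, η c ≠ 0 := fun c =>
    mul_ne_zero (neg_ne_zero.2 (by exact_mod_cast c.orientation.ne_zero)) (hχ _)
  have hmul : (D.definiteMatrix id).map (Int.cast : ℤ → ℂ) * Matrix.diagonal χ =
      Matrix.diagonal η * (D.alternatingMatrix id).map (Int.cast : ℤ → ℂ) := by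
    ext c R
    rw [Matrix.mul_diagonal, Matrix.diagonal_mul]
    simp only [Matrix.map_apply, definiteMatrix, alternatingMatrix, touchesAt_iff, Int.cast_sum,
      Finset.sum_mul, Finset.mul_sum]
    refine Finset.sum_congr rfl fun ε _ => Finset.sum_congr rfl fun δ _ => ?_
    by_cases hR : R = c.cornerRegion ε δ
    · rw [if_pos hR, if_pos hR, hR, hcol, c.cornerRegions.sign, hη]
      rcases Int.units_eq_one_or c.orientation with h | h <;> simp [h] <;> ring
    · simp [hR]
  rw [← Matrix.rank_map_intCast, ← Matrix.rank_map_intCast (D.alternatingMatrix id),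
    ← Matrix.rank_mul_eq_left_of_det_ne_zero (Matrix.diagonal χ)
      ((D.definiteMatrix id).map (Int.cast : ℤ → ℂ)) (by
        rw [Matrix.det_diagonal]; exact Finset.prod_ne_zero_iff.2 fun R _ => hχ R), hmul,
    Matrix.rank_mul_eq_right_of_det_ne_zero (Matrix.diagonal η) _ (by
        rw [Matrix.det_diagonal]; exact Finset.prod_ne_zero_iff.2 fun c _ => hη0 c)]

theorem rank_and_finrank_ker {m N : ℕ} {M : Type} {P : Type} [Fintype P] (A : Matrix M P ℤ)
    {k : ℕ} (hA : A.rank = k) (x : Fin m ≃ M) (R : Fin N ≃ P) :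
    (A.submatrix x R).rank = k ∧
      Module.finrank ℤ (LinearMap.ker (A.submatrix x R).mulVecLin) + k = N := by
  have h1 : (A.submatrix x R).rank = k := by rw [Matrix.rank_submatrix, hA]
  refine ⟨h1, ?_⟩
  rw [← h1, Matrix.finrank_ker_mulVecLin_add_rank, Fintype.card_fin]

end LinkDiagram

open LinkDiagram in
theorem mainTheorem1 {l d n : ℕ} (D : LinkDiagram l) (hn : 1 ≤ n)
    (hcrossings : Nat.card D.Crossing = n) (hcomponents : (components D.image).ncard = d) :
    -- the diagram on the plane
    ((D.regions (id : ℂ → ℂ)).ncard = n + d + 1 ∧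
      ∀ (x : Fin n ≃ D.Crossing) (R : Fin (n + d + 1) ≃ D.regions (id : ℂ → ℂ)),
        (((D.definiteMatrix id).submatrix x R).rank : ℤ) = n + d - l ∧
        (((D.alternatingMatrix id).submatrix x R).rank : ℤ) = n + d - l ∧
        Module.finrank ℤ
          (LinearMap.ker ((D.definiteMatrix id).submatrix x R).mulVecLin) = l + 1 ∧
        Module.finrank ℤ
          (LinearMap.ker ((D.alternatingMatrix id).submatrix x R).mulVecLin) = l + 1) ∧
    -- the diagram on the sphere
    ((D.regions (OnePoint.some : ℂ → OnePoint ℂ)).ncard = n + d + 1 ∧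
      ∀ (x : Fin n ≃ D.Crossing) (R : Fin (n + d + 1) ≃ D.regions (OnePoint.some : ℂ → OnePoint ℂ)),
        (((D.definiteMatrix OnePoint.some).submatrix x R).rank : ℤ) = n + d - l ∧
        (((D.alternatingMatrix OnePoint.some).submatrix x R).rank : ℤ) = n + d - l ∧
        Module.finrank ℤ
          (LinearMap.ker ((D.definiteMatrix OnePoint.some).submatrix x R).mulVecLin) = l + 1 ∧
        Module.finrank ℤ
          (LinearMap.ker ((D.alternatingMatrix OnePoint.some).submatrix x R).mulVecLin) = l + 1) := by
  classical
  -- `Nat.card` is `0` on infinite types, so `1 ≤ n` makes the set of crossings finite.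
  have hfin : Finite D.Crossing := (Nat.card_pos_iff.1 (by omega)).2
  have := Fintype.ofFinite D.Crossing
  have := Fintype.ofFinite (D.regions (id : ℂ → ℂ))
  rw [Nat.card_eq_fintype_card] at hcrossings
  have hcard : (D.regions (id : ℂ → ℂ)).ncard = n + d + 1 := by
    rw [ncard_regions, hcrossings, hcomponents]
  have ha := rank_alternatingMatrix (D := D)
  rw [hcrossings, hcomponents] at ha
  have hplane : ∀ (x : Fin n ≃ D.Crossing) (R : Fin (n + d + 1) ≃ D.regions (id : ℂ → ℂ)),
      (((D.definiteMatrix id).submatrix x R).rank : ℤ) = n + d - l ∧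
      (((D.alternatingMatrix id).submatrix x R).rank : ℤ) = n + d - l ∧
      Module.finrank ℤ
        (LinearMap.ker ((D.definiteMatrix id).submatrix x R).mulVecLin) = l + 1 ∧
      Module.finrank ℤ
        (LinearMap.ker ((D.alternatingMatrix id).submatrix x R).mulVecLin) = l + 1 := by
    intro x R
    obtain ⟨h1, h2⟩ := rank_and_finrank_ker (D.alternatingMatrix id) rfl x R
    obtain ⟨h3, h4⟩ := rank_and_finrank_ker (D.definiteMatrix id) rank_definiteMatrix x R
    refine ⟨?_, ?_, ?_, ?_⟩ <;> omega
  obtain ⟨e, he⟩ := D.exists_sphereRegions_equiv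
  refine ⟨⟨hcard, hplane⟩, ?_, fun x R => ?_⟩
  · rw [← Nat.card_coe_set_eq, Nat.card_congr e, Nat.card_coe_set_eq, hcard]
  · have htouch : ∀ (c : D.Crossing) (S : D.regions (OnePoint.some : ℂ → OnePoint ℂ)) (ε δ : ℤˣ),
        c.TouchesAt OnePoint.some (S : Set (OnePoint ℂ)) ε δ ↔
          c.TouchesAt id (e S : Set ℂ) ε δ := by
      intro c S ε δ
      rw [he]
      rfl
    -- Touching at a corner involves only finite points, so the sphere matrices are the plane
    -- matrices with columns relabelled by `e`.
    have hd : (D.definiteMatrix OnePoint.some).submatrix x R =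
        (D.definiteMatrix id).submatrix x (R.trans e) := by
      ext i j
      simp only [Matrix.submatrix_apply, definiteMatrix]
      refine Finset.sum_congr rfl fun ε _ => Finset.sum_congr rfl fun δ _ =>
        if_congr (htouch (x i) (R j) ε δ) rfl rfl
    have ha : (D.alternatingMatrix OnePoint.some).submatrix x R =
        (D.alternatingMatrix id).submatrix x (R.trans e) := by
      ext i j
      simp only [Matrix.submatrix_apply, alternatingMatrix]
      refine Finset.sum_congr rfl fun ε _ => Finset.sum_congr rfl fun δ _ =>
        if_congr (htouch (x i) (R j) ε δ) rfl rfl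
    rw [hd, ha]
    exact hplane x (R.trans e)
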